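/- Let $\mathbb F$ be an arbitrary field and let $D,E\subseteq\mathbb F$ be finite. A CSP instance $\mathcal P=(V,D,\mathcal C)$ over $D$ has a finite ordered list $V=(x_1,\dots,x_n)$ of variables and finitely many constraints $\langle\mathbf s,R\rangle$, $\mathbf s\in V^k$, $R\subseteq D^k$. A solution is a map $\varphi:V\to D$ that sends every scope $\mathbf s$ into its relation $R$. The ideal of $\mathcal P$ is $$\mathtt I(\mathcal P)=\sum_{\langle\mathbf s,R\rangle\in\mathcal C}\ \bigcap_{v\in R}\langle s_1-v_1,\dots,s_k-v_k\rangle+\Big\langle\prod_{a\in D}(x_i-a):1\le i\le n\Big\rangle\subseteq\mathbb F[V].$$ An instance of $\chi\mathrm{IMP}_d$ over $D$ is a pair $(M,\mathcal P)$ with $\mathcal P$ as above and a vector $M=(g_1,\dots,g_\ell)$ of polynomials in $\mathbb F[V]$ of total degree at most $d$. To solve it means to find a nonzero $\mathbf c\in\mathbb F^\ell$ with $\sum_i c_ig_i\in\mathtt I(\mathcal P)$, or to report that there is none. Gröbner bases are taken with respect to the graded lexicographic order with $x_1\succ x_2\succ\cdots$. A $d$-truncated Gröbner basis is the set of the elements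 of total degree at most $d$ of some (finite) Gröbner basis. Algorithms are programs of an algebraic machine over $\mathbb F$: they manipulate finite binary trees whose leaves are empty or carry one field element, a field operation or a zero test has constant cost, and reading or writing a tree costs its number of nodes. Polynomials are given as lists of terms (a coefficient and a vector of exponents written in unary), variables as numbers in unary. A CSP instance is given by its number of variables and the list of its constraints, and relations are written in an arbitrary fixed notation, one for relations on $D$ and one for relations on $E$. Polynomial time means polynomial in the number of nodes of the input. A substitution collection consists of finitely many surjections $\mu_i:E^{\ell_i}\to D$, $i\in[k]$, with polynomials $h_i$ over $\mathbb F$ in $\ell_i$ variables that interpolate them, $h_i|_{E^{\ell_i}}=\mu_i$. A class $\mathcal X$ of $\chi$IMP instances over $D$ is substitution reducible to a class $\mathcal Y$ of $\chi$IMP instances over $E$ with $\{h_1,\dots,h_k\}$ if a polynomial time algorithm computes, for every $(M,\mathcal P)\in\mathcal X$, for each variable $x$ of $\mathcal P$ an index $i_x\in[k]$ and a tuple $Y_x$ of $\ell_{i_x}$ distinct variables, together with a CSP instance $\mathcal P'$ over $E$, such that: * for all $x,y$ the sets of variables in $Y_x$ and $Y_y$ are equal or disjoint; * for every solution $\varphi$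 of $\mathcal P$ and every set $Z$ of variables there is an assignment $a:Z\to E$ with $\varphi(x)=h_{i_x}(a(Y_x))$ for all variables $x$ whose set is $Z$; * the variables of $\mathcal P'$ are exactly those in $\bigcup_xY_x$, and its constraints are exactly the constraints $\langle\mathbf s',R'\rangle$, for $\langle(s_1,\dots,s_t),R\rangle$ a constraint of $\mathcal P$, where $\mathbf s'$ is the concatenation of $Y_{s_1},\dots,Y_{s_t}$ and $R'$ is the relation on $E$ of all $(a_1,\dots,a_t)$ with $(h_{i_{s_1}}(a_1),\dots,h_{i_{s_t}}(a_t))\in R$; * $(M',\mathcal P')\in\mathcal Y$, where $M'$ arises from $M$ by substituting $h_{i_x}(Y_x)$ for each $x$. **Theorem.** Let $d\ge0$ and $r\ge1$, let $\mathcal X$ be a class of instances of $\chi\mathrm{IMP}_d$ over $D$ and $\mathcal Y$ a class of instances of $\chi\mathrm{IMP}_{rd}$ over $E$, such that $\mathcal X$ is substitution reducible to $\mathcal Y$ with a substitution collection $\{h_1,\dots,h_k\}$ and $\ell_i\le r$ for all $i\in[k]$. Suppose that a polynomial time algorithm constructs, for every $(M',\mathcal P')\in\mathcal Y$, a Gröbner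 basis or an $rd$-truncated Gröbner basis of $\mathtt I(\mathcal P')$. Then: 1. there is a polynomial time algorithm that solves every instance $(M,\mathcal P)\in\mathcal X$; 2. if $\mathcal X$ restricts only the CSP instances, that is, if $(M,\mathcal P)\in\mathcal X$ implies $(N,\mathcal P)\in\mathcal X$ for every vector $N$ of polynomials in $\mathbb F[V]$ of total degree at most $d$, then there is a polynomial time algorithm that constructs, for every $(M,\mathcal P)\in\mathcal X$, a $d$-truncated Gröbner basis of $\mathtt I(\mathcal P)$. -/

import Mathlib

namespace ChiIMP

universe u

/-! ### The machine model: a while-language on binary trees with leaves in a field -/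

/-- Data: finite binary trees whose leaves are empty or carry one element of the field. -/
inductive Data (F : Type u) : Type u
  | nil : Data F
  | atom (a : F) : Data F
  | cons (x y : Data F) : Data F

namespace Data

/-- The number of nodes; a field element has size one. -/
def size {F : Type u} : Data F → ℕ
  | nil => 1
  | atom _ => 1
  | cons x y => x.size + y.size + 1

/-- Lists, as right-nested pairs. -/
def ofList {F : Type u} : List (Data F) → Data F
  | [] => nil
  | x :: l => cons x (ofList l)

/-- Natural numbers, in unary. -/
def ofNat {F : Type u} (k : ℕ) : Data F := ofList (List.replicate k nil)

end Data

/-- Elementary instructions. -/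
inductive Instr (F : Type u) : Type u
  | skip : Instr F
  | const (v : Data F) : Instr F
  | head : Instr F
  | tail : Instr F
  | isCons : Instr F
  | isZero : Instr F
  | add : Instr F
  | mul : Instr F
  | inv : Instr F

open Classical in
/-- The effect of an instruction. Arithmetic instructions act on field elements, and tests answer
with `nil` for "no" and with a pair for "yes". An instruction that does not apply yields `nil`. -/
noncomputable def Instr.run {F : Type u} [Field F] : Instr F → Data F → Data F
  | .skip, x => x
  | .const v, _ => v
  | .head, .cons x _ => x
  | .tail, .cons _ y => y
  | .isCons, .cons _ _ => .cons .nil .nil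
  | .isZero, .atom a => if a = 0 then .cons .nil .nil else .nil
  | .add, .cons (.atom a) (.atom b) => .atom (a + b)
  | .mul, .cons (.atom a) (.atom b) => .atom (a * b)
  | .inv, .atom a => .atom a⁻¹
  | _, _ => .nil

/-- Programs; each is a finite object and computes a partial function from data to data. -/
inductive Prog (F : Type u) : Type u
  | instr (i : Instr F) : Prog F
  | seq (p q : Prog F) : Prog F
  | pair (p q : Prog F) : Prog F
  | ite (c p q : Prog F) : Prog F
  | loop (c p : Prog F) : Prog F

/-- `Exec p x y t`: on input `x` the program `p` halts with output `y` at cost `t`.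
An elementary instruction costs one plus the sizes of the data that it reads and writes (so a field
operation or a zero test has constant cost, and copying a tree costs its size). `pair p q` runs `p`
and `q` on the same input and pairs the outputs; `ite c p q` branches on whether `c` answers `nil`;
`loop c p` repeats `p` as long as `c` does not answer `nil`. -/
inductive Exec {F : Type u} [Field F] : Prog F → Data F → Data F → ℕ → Prop
  | instr (i : Instr F) (x : Data F) :
      Exec (.instr i) x (i.run x) (1 + x.size + (i.run x).size)
  | seq {p q : Prog F} {x y z : Data F} {s t : ℕ} (hp : Exec p x y s) (hq : Exec q y z t) :
      Exec (.seq p q) x z (s + t + 1)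
  | pair {p q : Prog F} {x y z : Data F} {s t : ℕ} (hp : Exec p x y s) (hq : Exec q x z t) :
      Exec (.pair p q) x (.cons y z) (s + t + 1)
  | iteTrue {c p q : Prog F} {x b y : Data F} {s t : ℕ} (hc : Exec c x b s) (hb : b ≠ .nil)
      (hp : Exec p x y t) : Exec (.ite c p q) x y (s + t + 1)
  | iteFalse {c p q : Prog F} {x y : Data F} {s t : ℕ} (hc : Exec c x .nil s)
      (hq : Exec q x y t) : Exec (.ite c p q) x y (s + t + 1)
  | loopDone {c p : Prog F} {x : Data F} {s : ℕ} (hc : Exec c x .nil s) :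
      Exec (.loop c p) x x (s + 1)
  | loopStep {c p : Prog F} {x b y z : Data F} {s t w : ℕ} (hc : Exec c x b s) (hb : b ≠ .nil)
      (hp : Exec p x y t) (hl : Exec (.loop c p) y z w) :
      Exec (.loop c p) x z (s + t + w + 1)

/-- On every code `x` of every object `a ∈ S` the program `p` halts, within a number of steps
that is polynomial in the size of `x`, with an output `y` that satisfies `post a y`. -/
def PolyTimeOn {F : Type u} [Field F] {α : Type*} (p : Prog F) (codes : Data F → α → Prop)
    (S : Set α) (post : α → Data F → Prop) : Prop :=
  ∃ T : Polynomial ℕ, ∀ a ∈ S, ∀ x : Data F, codes x a →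
    ∃ (y : Data F) (t : ℕ), Exec p x y t ∧ t ≤ T.eval x.size ∧ post a y

/-! ### Constraint satisfaction problems and their ideals -/

/-- A constraint `⟨s, R⟩` on variables indexed by `Fin n`, over the domain `D ⊆ F`. -/
structure Constraint {F : Type u} (D : Finset F) (n : ℕ) where
  arity : ℕ
  scope : Fin arity → Fin n
  rel : Set (Fin arity → D)

/-- A CSP instance over the domain `D`. -/
structure CSP {F : Type u} (D : Finset F) where
  numVars : ℕ
  constraints : List (Constraint D numVars)

/-- `φ` is a solution of `P`. -/
def CSP.IsSolution {F : Type u} {D : Finset F} (P : CSP D) (φ : Fin P.numVars → D) : Prop :=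
  ∀ c ∈ P.constraints, (fun j => φ (c.scope j)) ∈ c.rel

/-- The ideal of a constraint: the intersection over the tuples `v ∈ R` of the ideals
generated by `x_{s_1} - v_1, …, x_{s_k} - v_k`. -/
noncomputable def Constraint.ideal {F : Type u} [Field F] {D : Finset F} {n : ℕ}
    (c : Constraint D n) : Ideal (MvPolynomial (Fin n) F) :=
  ⨅ v ∈ c.rel, Ideal.span (Set.range fun j : Fin c.arity =>
    MvPolynomial.X (c.scope j) - MvPolynomial.C ((v j : D) : F))

/-- The combinatorial ideal of `P`: the sum of the ideals of the constraints and of the ideal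
generated by the domain polynomials `∏_{a ∈ D} (x_i - a)` of all variables. -/
noncomputable def CSP.ideal {F : Type u} [Field F] {D : Finset F} (P : CSP D) :
    Ideal (MvPolynomial (Fin P.numVars) F) :=
  (⨆ c ∈ P.constraints, c.ideal) ⊔ Ideal.span (Set.range fun i : Fin P.numVars =>
    ∏ a ∈ D, (MvPolynomial.X i - MvPolynomial.C a))

/-- An instance `(M, P)` of the χIMP: a CSP instance and a vector of polynomials. -/
structure Inst {F : Type u} [Field F] (D : Finset F) where
  csp : CSP D
  polys : List (MvPolynomial (Fin csp.numVars) F)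

/-- The χIMP with polynomials of total degree at most `d`. -/
def chiIMP {F : Type u} [Field F] (D : Finset F) (d : ℕ) : Set (Inst D) :=
  {I | ∀ g ∈ I.polys, g.totalDegree ≤ d}

/-- `c` is a nonzero vector of coefficients with `∑ c_i g_i` in the ideal of the instance. -/
def Inst.IsWitness {F : Type u} [Field F] {D : Finset F} (I : Inst D)
    (c : Fin I.polys.length → F) : Prop :=
  c ≠ 0 ∧ ∑ i, c i • I.polys.get i ∈ I.csp.ideal

/-! ### Gröbner bases for the graded lexicographic order with `x_0 > x_1 > ⋯` -/

/-- `G` is a Gröbner basis of `J`. -/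
def IsGroebner {F : Type u} [Field F] {n : ℕ} (J : Ideal (MvPolynomial (Fin n) F))
    (G : Set (MvPolynomial (Fin n) F)) : Prop :=
  G.Finite ∧ G ⊆ J ∧
    Ideal.span ((MonomialOrder.degLex (σ := Fin n)).leadingTerm '' G) =
      Ideal.span ((MonomialOrder.degLex (σ := Fin n)).leadingTerm '' (J : Set _))

/-- `G` is a `d`-truncated Gröbner basis of `J`. -/
def IsTruncGroebner {F : Type u} [Field F] {n : ℕ} (d : ℕ)
    (J : Ideal (MvPolynomial (Fin n) F)) (G : Set (MvPolynomial (Fin n) F)) : Prop :=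
  ∃ B, IsGroebner J B ∧ G = {g | g ∈ B ∧ g.totalDegree ≤ d}

/-! ### Codes -/

/-- `x` is a list of codes of the members of `l`. -/
def CodesList {F : Type u} {α : Type*} (R : Data F → α → Prop) (x : Data F) (l : List α) : Prop :=
  ∃ xs : List (Data F), x = Data.ofList xs ∧ List.Forall₂ R xs l

/-- Codes of polynomials: lists of terms, each a coefficient with a vector of exponents. The
list stands for the sum of its terms. -/
def CodesPoly {F : Type u} [Field F] {n : ℕ} (x : Data F) (g : MvPolynomial (Fin n) F) : Prop :=
  ∃ ts : List (F × (Fin n → ℕ)),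
    x = Data.ofList (ts.map fun t =>
      Data.cons (Data.atom t.1) (Data.ofList (List.ofFn fun i => Data.ofNat (t.2 i)))) ∧
    g = (ts.map fun t =>
      MvPolynomial.monomial (Finsupp.equivFunOnFinite.symm t.2) t.1).sum

/-- A notation for the relations on `D` (for example explicit tables, or names of the members of
a finite constraint language): it assigns to some data the relation that they denote. -/
def RelNotation {F : Type u} (D : Finset F) : Type u :=
  Data F → Option (Σ k : ℕ, Set (Fin k → D))

/-- Codes of constraints: the scope, and the relation in the given notation. -/
def CodesConstraint {F : Type u} {D : Finset F} (ν : RelNotation D) {n : ℕ} (x : Data F)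
    (c : Constraint D n) : Prop :=
  ∃ y : Data F, x = Data.cons (Data.ofList (List.ofFn fun j => Data.ofNat (c.scope j))) y ∧
    ν y = some ⟨c.arity, c.rel⟩

/-- Codes of CSP instances: the number of variables, and the list of constraints. -/
def CodesCSP {F : Type u} {D : Finset F} (ν : RelNotation D) (x : Data F) (P : CSP D) : Prop :=
  ∃ y : Data F, x = Data.cons (Data.ofNat P.numVars) y ∧
    CodesList (CodesConstraint ν) y P.constraints

/-- Codes of instances of the χIMP. -/
def CodesInst {F : Type u} [Field F] {D : Finset F} (ν : RelNotation D) (x : Data F)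
    (I : Inst D) : Prop :=
  ∃ y z : Data F, x = Data.cons y z ∧ CodesList CodesPoly y I.polys ∧ CodesCSP ν z I.csp

/-! ### Substitution reductions -/

/-- A substitution collection: surjections `μ_i : E^{ℓ_i} → D` for `i < k`, with interpolating
polynomials `h_i`. -/
structure SubstCollection {F : Type u} [Field F] (D E : Finset F) where
  k : ℕ
  arity : Fin k → ℕ
  map : ∀ i : Fin k, (Fin (arity i) → E) → D
  map_surjective : ∀ i, Function.Surjective (map i)
  poly : ∀ i : Fin k, MvPolynomial (Fin (arity i)) F
  eval_poly : ∀ (i : Fin k) (a : Fin (arity i) → E),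
    MvPolynomial.eval (fun j => ((a j : E) : F)) (poly i) = ((map i a : D) : F)

/-- A choice, for each of `n` variables `x`, of an index `i_x` and of an `ℓ_{i_x}`-tuple `Y_x` of
variables among `m` new ones. -/
structure Choice {F : Type u} [Field F] {D E : Finset F} (S : SubstCollection D E) (n m : ℕ) where
  idx : Fin n → Fin S.k
  vars : ∀ x : Fin n, Fin (S.arity (idx x)) → Fin m

/-- The code of a choice: the list of the pairs `(i_x, Y_x)`. -/
def Choice.code {F : Type u} [Field F] {D E : Finset F} {S : SubstCollection D E} {n m : ℕ}
    (s : Choice S n m) : Data F :=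
  Data.ofList (List.ofFn fun x => Data.cons (Data.ofNat (s.idx x))
    (Data.ofList (List.ofFn fun j => Data.ofNat (s.vars x j))))

/-- The polynomial `g(h_{i_{x_1}}(Y_{x_1}), …, h_{i_{x_n}}(Y_{x_n}))`. -/
noncomputable def Choice.subst {F : Type u} [Field F] {D E : Finset F} {S : SubstCollection D E}
    {n m : ℕ} (s : Choice S n m) (g : MvPolynomial (Fin n) F) : MvPolynomial (Fin m) F :=
  MvPolynomial.bind₁ (fun x => MvPolynomial.rename (s.vars x) (S.poly (s.idx x))) g

/-- The constraint `⟨s', R'⟩`: the scope is the concatenation of the tuples `Y_x` along the scope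
of `c`, and `R'` is the preimage of the relation of `c` under the functions `h_{i_x}`. -/
def Choice.constraint {F : Type u} [Field F] {D E : Finset F} {S : SubstCollection D E}
    {n m : ℕ} (s : Choice S n m) (c : Constraint D n) : Constraint E m where
  arity := ∑ j : Fin c.arity, S.arity (s.idx (c.scope j))
  scope := fun p => s.vars (c.scope (finSigmaFinEquiv.symm p).1) (finSigmaFinEquiv.symm p).2
  rel := {b | (fun j : Fin c.arity =>
    S.map (s.idx (c.scope j)) fun q => b (finSigmaFinEquiv ⟨j, q⟩)) ∈ c.rel}

/-- The conditions on the choice `s` and on the instance `P'` that is constructed from `P`. -/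
structure Choice.Valid {F : Type u} [Field F] {D E : Finset F} {S : SubstCollection D E}
    (P : CSP D) (P' : CSP E) (s : Choice S P.numVars P'.numVars) : Prop where
  /-- `Y_x` consists of `ℓ_{i_x}` distinct variables -/
  injective : ∀ x, Function.Injective (s.vars x)
  eq_or_disjoint : ∀ x y, Set.range (s.vars x) = Set.range (s.vars y) ∨
    Disjoint (Set.range (s.vars x)) (Set.range (s.vars y))
  /-- the values under a solution of the variables with a common set `Y_x` come from
  a common assignment to that set -/
  common : ∀ φ : Fin P.numVars → D, P.IsSolution φ → ∀ x₀ : Fin P.numVars,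
    ∃ a : Fin P'.numVars → E, ∀ x, Set.range (s.vars x) = Set.range (s.vars x₀) →
      ((φ x : D) : F) =
        MvPolynomial.eval (fun j => ((a (s.vars x j) : E) : F)) (S.poly (s.idx x))
  /-- the variables of `P'` are those in the sets `Y_x` -/
  cover : ∀ y : Fin P'.numVars, ∃ x, y ∈ Set.range (s.vars x)
  constraints : ∀ c' : Constraint E P'.numVars,
    c' ∈ P'.constraints ↔ ∃ c ∈ P.constraints, c' = s.constraint c

/-- `X` is substitution reducible to `Y` with the substitution collection `S`: a polynomial time
algorithm finds, for every instance `(M, P)` of `X`, a valid choice of the `h_{i_x}` and `Y_x`,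
and the instance `P'`, such that `(M', P')` belongs to `Y`, where `M'` is obtained from `M` by
substitution. -/
def SubstReducible {F : Type u} [Field F] {D E : Finset F} (νX : RelNotation D)
    (νY : RelNotation E) (X : Set (Inst D)) (Y : Set (Inst E)) (S : SubstCollection D E) : Prop :=
  ∃ A : Prog F, PolyTimeOn A (CodesInst νX) X fun I y =>
    ∃ (P' : CSP E) (s : Choice S I.csp.numVars P'.numVars) (z : Data F),
      y = Data.cons s.code z ∧ CodesCSP νY z P' ∧ s.Valid I.csp P' ∧
      (⟨P', I.polys.map s.subst⟩ : Inst E) ∈ Y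

/-! ### The problems to be solved -/

/-- `y` answers the instance `I` of the χIMP: it is `nil` if there is no nonzero vector `c` with
`∑ c_i g_i` in the ideal, and otherwise the list of the entries of such a vector. -/
def Answers {F : Type u} [Field F] {D : Finset F} (I : Inst D) (y : Data F) : Prop :=
  (y = Data.nil ∧ ¬ ∃ c, I.IsWitness c) ∨
    ∃ c, I.IsWitness c ∧ y = Data.ofList (List.ofFn fun i => Data.atom (c i))

/-- `y` lists a `d`-truncated Gröbner basis of the ideal of `I`. -/
def ListsTruncGroebner {F : Type u} [Field F] {D : Finset F} (d : ℕ) (I : Inst D)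
    (y : Data F) : Prop :=
  ∃ G : List (MvPolynomial (Fin I.csp.numVars) F), CodesList CodesPoly y G ∧
    IsTruncGroebner d I.csp.ideal {g | g ∈ G}

/-- `y` lists a Gröbner basis of the ideal of `I`. -/
def ListsGroebner {F : Type u} [Field F] {D : Finset F} (I : Inst D) (y : Data F) : Prop :=
  ∃ G : List (MvPolynomial (Fin I.csp.numVars) F), CodesList CodesPoly y G ∧
    IsGroebner I.csp.ideal {g | g ∈ G}

end ChiIMP

namespace ChiIMP

universe u v

/-! ### Polynomial time functions between encoded types -/

/-! Over any field the ideal of an instance is the vanishing ideal of its set of solutions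
(`CSP.mem_ideal_iff`): by the combinatorial Nullstellensatz the domain polynomials generate all
polynomials vanishing on `D^n`, and the Lagrange indicator of a non-solution lies in the ideal of a
violated constraint. The surjections of the collection map solutions of `P'` onto solutions of `P`;
preimages are glued from assignments on the blocks `Y_x`, which are equal or disjoint. Hence
substitution preserves and reflects ideal membership (`Choice.Valid.subst_mem_ideal_iff`). Since it
is linear, the vectors `c` with `∑ c_i g_i` in the ideal are the same before and after substitution.

On the side of `P'`, division in a graded order never raises the degree. So the elements of the
ideal of degree at most `k` are linear combinations of products of monomials and basis elements,
both of degree at most `k` (`IsGroebner.mem_span`). For fixed `k` these products form a list of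
polynomial length, and ideal membership becomes membership in a finite span
(`mem_span_multiples_iff`). Solving an instance is then linear algebra: find a nonzero relation
modulo that span (`findRelation_spec`). For a truncated basis the same is done with the vector of
all monomials of degree at most `d`: relations of a monomial with smaller ones, with nonzero
coefficient at that monomial, are elements of the ideal with prescribed leading monomial
(`isTruncGroebner_withLeading`).

Running times come from a calculus of polynomial time functions (`PolyFn`), closed under
composition, pairing, case distinction and folds whose accumulator stays polynomially small. Sizes
could explode at two places. Elimination keeps the number of generators constant, and field elements
have size one (`PolyFn.linearRelations`). Substitution multiplies at most `d` factors, because terms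
of larger degree, which cancel in an admissible input, are dropped (`substTerms_spec`). Everything
is assembled in `exists_linearization`, which serves both parts of the theorem. -/

/-- A type whose members are encoded as data over `F`. -/
class Code (F : Type u) (α : Type v) where
  toData : α → Data F

/-- The code of `a`. -/
def enc (F : Type u) {α : Type v} [Code F α] (a : α) : Data F := Code.toData a

/-! ### Codes of basic types and their sizes. -/

section Codes

variable {F : Type u}

instance : Code F (Data F) := ⟨id⟩

instance : Code F F := ⟨Data.atom⟩

instance : Code F ℕ := ⟨Data.ofNat⟩

instance : Code F Unit := ⟨fun _ => Data.nil⟩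

instance : Code F Bool := ⟨fun b => cond b (.cons .nil .nil) .nil⟩

instance {α β : Type*} [Code F α] [Code F β] : Code F (α × β) :=
  ⟨fun a => .cons (enc F a.1) (enc F a.2)⟩

instance {α : Type*} [Code F α] : Code F (List α) := ⟨fun l => Data.ofList (l.map (enc F))⟩

variable {α β : Type*} [Code F α] [Code F β]

theorem enc_data (x : Data F) : enc F x = x := rfl

theorem enc_field (a : F) : enc F a = Data.atom a := rfl

theorem enc_nat (k : ℕ) : enc F k = Data.ofNat k := rfl

theorem enc_pair (a : α) (b : β) : enc F (a, b) = .cons (enc F a) (enc F b) := rfl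

theorem enc_cons (a : α) (l : List α) : enc F (a :: l) = .cons (enc F a) (enc F l) := rfl

theorem enc_list (l : List α) : enc F l = Data.ofList (l.map (enc F)) := rfl

/-- Unary numbers and lists of units are the same trees, so arithmetic on numbers reduces to list
operations. -/
theorem enc_replicate_unit (k : ℕ) : enc F (List.replicate k ()) = enc F k := by
  simp [Data.ofNat, enc, Code.toData]

theorem enc_true : enc F true = .cons .nil .nil := rfl

theorem enc_false : enc F false = .nil := rfl

theorem Data.size_pos (x : Data F) : 1 ≤ x.size := by
  cases x <;> simp [Data.size]

theorem size_enc_pair (a : α) (b : β) :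
    (enc F (a, b)).size = (enc F a).size + (enc F b).size + 1 := rfl

theorem size_enc_nil : (enc F ([] : List α)).size = 1 := rfl

theorem size_enc_cons (a : α) (l : List α) :
    (enc F (a :: l)).size = (enc F a).size + (enc F l).size + 1 := rfl

theorem size_enc_bool (b : Bool) : (enc F b).size ≤ 3 := by
  cases b <;> simp [enc_true, enc_false, Data.size]

theorem size_enc_append (l l' : List α) :
    (enc F (l ++ l')).size + 1 = (enc F l).size + (enc F l').size := by
  induction l with
  | nil => simp only [List.nil_append, size_enc_nil]; omega
  | cons a l ih => simp only [List.cons_append, size_enc_cons]; omega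

theorem size_enc_reverse (l : List α) : (enc F l.reverse).size = (enc F l).size := by
  induction l with
  | nil => rfl
  | cons a l ih =>
    have := size_enc_append (F := F) l.reverse [a]
    simp only [List.reverse_cons, size_enc_cons, size_enc_nil] at this ⊢
    omega

theorem size_enc_le_of_mem {a : α} {l : List α} (h : a ∈ l) :
    (enc F a).size + 1 ≤ (enc F l).size := by
  induction l with
  | nil => simp at h
  | cons b l ih =>
    have h1 := Data.size_pos (enc F l)
    have h2 := Data.size_pos (enc F b)
    rw [size_enc_cons]
    rcases List.mem_cons.1 h with rfl | h
    · omega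
    · have := ih h; omega

theorem size_enc_le_of_prefix {l l' : List α} (h : l' <+: l) :
    (enc F l').size ≤ (enc F l).size := by
  obtain ⟨t, rfl⟩ := h
  have := size_enc_append (F := F) l' t
  have := Data.size_pos (enc F t)
  omega

theorem size_enc_le_of_suffix {l l' : List α} (h : l' <:+ l) :
    (enc F l').size ≤ (enc F l).size := by
  obtain ⟨t, rfl⟩ := h
  have := size_enc_append (F := F) t l'
  have := Data.size_pos (enc F t)
  omega

theorem length_lt_size_enc (l : List α) : l.length < (enc F l).size := by
  induction l with
  | nil => simp [size_enc_nil]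
  | cons a l ih =>
    have := Data.size_pos (enc F a)
    rw [size_enc_cons, List.length_cons]; omega

theorem size_enc_list_le {l : List α} {m : ℕ} (h : ∀ a ∈ l, (enc F a).size ≤ m) :
    (enc F l).size ≤ l.length * (m + 1) + 1 := by
  induction l with
  | nil => simp [size_enc_nil]
  | cons a l ih =>
    have h1 := ih fun b hb => h b (List.mem_cons_of_mem _ hb)
    have h2 := h a List.mem_cons_self
    rw [size_enc_cons, List.length_cons, Nat.succ_mul]; omega

theorem size_enc_nat (k : ℕ) : (enc F k).size = 2 * k + 1 := by
  rw [← enc_replicate_unit]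
  induction k with
  | zero => rfl
  | succ k ih =>
    rw [List.replicate_succ, size_enc_cons, ih]
    change 1 + _ + 1 = _
    omega

end Codes

theorem eval_mono (T : Polynomial ℕ) {a b : ℕ} (h : a ≤ b) : T.eval a ≤ T.eval b := by
  rw [Polynomial.eval_eq_sum, Polynomial.eval_eq_sum, Polynomial.sum, Polynomial.sum]
  gcongr

/-! ### Basic closure properties of polynomial time functions. -/

section PolyFn

variable {F : Type u} [Field F]

/-- Instructions pay for what they read and write, so a time bound is also a bound on the size of
the output. This is what makes compositions polynomial. -/
theorem Exec.size_le {p : Prog F} {x y : Data F} {t : ℕ} (h : Exec p x y t) :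
    x.size ≤ t ∧ y.size ≤ t := by
  induction h with
  | instr i x => omega
  | pair => simp only [Data.size]; omega
  | _ => omega

theorem Instr.size_run_le (i : Instr F) : ∃ C, ∀ x, (i.run x).size ≤ x.size + C := by
  cases i with
  | const v => exact ⟨v.size, fun x => by simp [Instr.run]⟩
  | _ =>
    refine ⟨3, fun x => ?_⟩
    unfold Instr.run
    split <;> simp_all [Data.size] <;> try omega
    try (split <;> simp [Data.size])

/-- Case distinction on a list. -/
def listCases {β γ : Type*} (l : List β) (n : γ) (c : β → List β → γ) : γ :=
  match l with
  | [] => n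
  | b :: t => c b t

variable (F) in
/-- `f` is computed on codes by a program that runs in polynomial time. -/
def PolyFn {α β : Type*} [Code F α] [Code F β] (f : α → β) : Prop :=
  ∃ (p : Prog F) (T : Polynomial ℕ), ∀ a, ∃ t,
    Exec p (enc F a) (enc F (f a)) t ∧ t ≤ T.eval (enc F a).size

namespace PolyFn

variable {α β γ σ : Type*} [Code F α] [Code F β] [Code F γ] [Code F σ]

/-- A program sees only codes, so a value may be reinterpreted at no cost in any type where it has
the same code. -/
theorem of_enc_eq {f : α → β} {g : α → γ} (hf : PolyFn F f)
    (h : ∀ a, enc F (f a) = enc F (g a)) : PolyFn F g := by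
  obtain ⟨p, T, hp⟩ := hf
  exact ⟨p, T, fun a => h a ▸ hp a⟩

theorem size_le {f : α → β} (hf : PolyFn F f) :
    ∃ T : Polynomial ℕ, ∀ a, (enc F (f a)).size ≤ T.eval (enc F a).size := by
  obtain ⟨p, T, hp⟩ := hf
  refine ⟨T, fun a => ?_⟩
  obtain ⟨t, h, ht⟩ := hp a
  exact h.size_le.2.trans ht

theorem of_instr {f : α → β} (i : Instr F) (h : ∀ a, i.run (enc F a) = enc F (f a)) :
    PolyFn F f := by
  obtain ⟨C, hC⟩ := i.size_run_le
  refine ⟨.instr i, 2 * Polynomial.X + (1 + Polynomial.C C), fun a => ⟨_, h a ▸ Exec.instr i _, ?_⟩⟩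
  have := hC (enc F a)
  rw [h a] at this
  simp
  omega

theorem comp {g : β → γ} {f : α → β} (hg : PolyFn F g) (hf : PolyFn F f) :
    PolyFn F fun a => g (f a) := by
  obtain ⟨p, T, hp⟩ := hf
  obtain ⟨q, U, hq⟩ := hg
  refine ⟨.seq p q, T + U.comp T + 1, fun a => ?_⟩
  obtain ⟨s, hs, hs'⟩ := hp a
  obtain ⟨t, ht, ht'⟩ := hq (f a)
  refine ⟨_, .seq hs ht, ?_⟩
  have := eval_mono U (hs.size_le.2.trans hs')
  simp only [Polynomial.eval_add, Polynomial.eval_comp, Polynomial.eval_one]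
  omega

theorem pair {f : α → β} {g : α → γ} (hf : PolyFn F f) (hg : PolyFn F g) :
    PolyFn F fun a => (f a, g a) := by
  obtain ⟨p, T, hp⟩ := hf
  obtain ⟨q, U, hq⟩ := hg
  refine ⟨.pair p q, T + U + 1, fun a => ?_⟩
  obtain ⟨s, hs, hs'⟩ := hp a
  obtain ⟨t, ht, ht'⟩ := hq a
  refine ⟨_, .pair hs ht, ?_⟩
  simp only [Polynomial.eval_add, Polynomial.eval_one]
  omega

theorem id : PolyFn F fun a : α => a := of_instr .skip fun _ => rfl

theorem const (b : β) : PolyFn F fun _ : α => b := of_instr (.const (enc F b)) fun _ => rfl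

theorem fst : PolyFn F fun a : α × β => a.1 := of_instr .head fun _ => rfl

theorem snd : PolyFn F fun a : α × β => a.2 := of_instr .tail fun _ => rfl

theorem comp₂ {g : β → γ → σ} {f₁ : α → β} {f₂ : α → γ}
    (hg : PolyFn F fun p : β × γ => g p.1 p.2) (h₁ : PolyFn F f₁) (h₂ : PolyFn F f₂) :
    PolyFn F fun a => g (f₁ a) (f₂ a) := hg.comp (h₁.pair h₂)

theorem cond {c : α → Bool} {f g : α → β} (hc : PolyFn F c) (hf : PolyFn F f)
    (hg : PolyFn F g) : PolyFn F fun a => bif c a then f a else g a := by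
  obtain ⟨r, R, hr⟩ := hc
  obtain ⟨p, T, hp⟩ := hf
  obtain ⟨q, U, hq⟩ := hg
  refine ⟨.ite r p q, R + T + U + 1, fun a => ?_⟩
  obtain ⟨b, hb, hb'⟩ := hr a
  obtain ⟨s, hs, hs'⟩ := hp a
  obtain ⟨t, ht, ht'⟩ := hq a
  simp only [Polynomial.eval_add, Polynomial.eval_one]
  cases h : c a
  · rw [h] at hb
    exact ⟨_, .iteFalse hb ht, by omega⟩
  · rw [h] at hb
    exact ⟨_, .iteTrue hb (by simp [enc_true]) hs, by omega⟩

theorem cons {f : α → β} {l : α → List β} (hf : PolyFn F f) (hl : PolyFn F l) :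
    PolyFn F fun a => f a :: l a := (hf.pair hl).of_enc_eq fun _ => rfl

theorem tail {l : α → List β} (hl : PolyFn F l) : PolyFn F fun a => (l a).tail :=
  comp (g := List.tail) (of_instr .tail fun l => by cases l <;> rfl) hl

theorem isCons {l : α → List β} (hl : PolyFn F l) : PolyFn F fun a => !(l a).isEmpty :=
  comp (g := fun l : List β => !l.isEmpty) (of_instr .isCons fun l => by cases l <;> rfl) hl

theorem not {c : α → Bool} (hc : PolyFn F c) : PolyFn F fun a => !c a :=
  (hc.cond (const false) (const true)).of_enc_eq fun a => by cases c a <;> rfl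

theorem and {c c' : α → Bool} (hc : PolyFn F c) (hc' : PolyFn F c') :
    PolyFn F fun a => c a && c' a :=
  (hc.cond hc' (const false)).of_enc_eq fun a => by cases c a <;> rfl

theorem or {c c' : α → Bool} (hc : PolyFn F c) (hc' : PolyFn F c') :
    PolyFn F fun a => c a || c' a :=
  (hc.cond (const true) hc').of_enc_eq fun a => by cases c a <;> rfl

theorem isEmpty {l : α → List β} (hl : PolyFn F l) : PolyFn F fun a => (l a).isEmpty :=
  hl.isCons.not.of_enc_eq fun a => by simp

theorem add {f g : α → F} (hf : PolyFn F f) (hg : PolyFn F g) : PolyFn F fun a => f a + g a :=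
  comp₂ (g := fun a b : F => a + b) (of_instr .add fun _ => rfl) hf hg

theorem mul {f g : α → F} (hf : PolyFn F f) (hg : PolyFn F g) : PolyFn F fun a => f a * g a :=
  comp₂ (g := fun a b : F => a * b) (of_instr .mul fun _ => rfl) hf hg

theorem inv {f : α → F} (hf : PolyFn F f) : PolyFn F fun a => (f a)⁻¹ :=
  comp (g := fun a : F => a⁻¹) (of_instr .inv fun _ => rfl) hf

open Classical in
theorem isZero {f : α → F} (hf : PolyFn F f) : PolyFn F fun a => decide (f a = 0) :=
  comp (g := fun a : F => decide (a = 0)) (of_instr .isZero fun a => by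
    by_cases h : a = 0 <;> simp [h, enc_field, Instr.run, enc_true, enc_false]) hf

/-- A nonempty list has the same code as the pair of its head and tail, so after the test the branch
is run directly on the input paired with the list. -/
theorem listCases {l : α → List β} {n : α → γ} {c : α → β → List β → γ} (hl : PolyFn F l)
    (hn : PolyFn F n) (hc : PolyFn F fun p : α × β × List β => c p.1 p.2.1 p.2.2) :
    PolyFn F fun a => ChiIMP.listCases (l a) (n a) (c a) := by
  obtain ⟨r, R, hr⟩ := hl.isCons
  obtain ⟨p, T, hp⟩ := hn
  obtain ⟨e, P, he⟩ := PolyFn.id.pair hl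
  obtain ⟨q, U, hq⟩ := hc
  refine ⟨.ite r (.seq e q) p, R + T + (P + U.comp P + 1) + 1, fun a => ?_⟩
  obtain ⟨b, hb, hb'⟩ := hr a
  obtain ⟨s, hs, hs'⟩ := hp a
  obtain ⟨t, ht, ht'⟩ := he a
  simp only [Polynomial.eval_add, Polynomial.eval_one, Polynomial.eval_comp]
  cases h : l a with
  | nil =>
    simp only [h] at hb
    exact ⟨_, .iteFalse hb hs, by omega⟩
  | cons x l' =>
    simp only [h] at hb ht
    obtain ⟨w, hw, hw'⟩ := hq (a, x, l')
    refine ⟨_, .iteTrue hb (by simp [enc_true]) (.seq ht hw), ?_⟩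
    have := eval_mono U (ht.size_le.2.trans ht')
    have : w ≤ U.eval (P.eval (enc F a).size) := hw'.trans this
    omega

/-- The loop runs on triples of input, accumulator and remaining list. A step that is polynomial in
its own input could still square the accumulator each time, so its size has to be controlled
separately along all prefixes. -/
theorem foldl {l : α → List β} {s : α → σ} {g : α → σ → β → σ} (hl : PolyFn F l)
    (hs : PolyFn F s) (hg : PolyFn F fun p : α × σ × β => g p.1 p.2.1 p.2.2)
    (hb : ∃ Q : Polynomial ℕ, ∀ a l', l' <+: l a →
      (enc F (l'.foldl (g a) (s a))).size ≤ Q.eval (enc F a).size) :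
    PolyFn F fun a => (l a).foldl (g a) (s a) := by
  obtain ⟨Q, hQ⟩ := hb
  obtain ⟨L, hL⟩ := hl.size_le
  obtain ⟨pi, I, hi⟩ := PolyFn.id.pair (hs.pair hl)
  obtain ⟨pc, C, hc⟩ := (isCons (F := F) (α := α × σ × List β) (l := fun x => x.2.2) (snd.comp snd))
  -- The body is only run when the remaining list is nonempty, so that list may be typed as a pair.
  have hstep : PolyFn F fun x : α × σ × (β × List β) => (x.1, g x.1 x.2.1 x.2.2.1, x.2.2.2) :=
    fst.pair (pair (hg.comp (f := fun x : α × σ × (β × List β) => (x.1, x.2.1, x.2.2.1))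
      (fst.pair ((fst.comp snd).pair (fst.comp (snd.comp snd))))) (snd.comp (snd.comp snd)))
  obtain ⟨pb, B, hbody⟩ := hstep
  obtain ⟨po, O, ho⟩ := (PolyFn.fst (F := F).comp (PolyFn.snd) :
    PolyFn F fun x : α × σ × List β => x.2.1)
  -- `A` bounds the size of every state met by the loop and stays fixed in the induction; the
  -- condition on prefixes passes to the tail with the updated accumulator.
  have loop : ∀ (A : ℕ) (a : α) (l : List β) (s : σ),
      (∀ l', l' <+: l → (enc F a).size + (enc F (l'.foldl (g a) s)).size + (enc F l).size + 2 ≤ A) →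
      ∃ t, Exec (.loop pc pb) (enc F (a, s, l)) (enc F (a, l.foldl (g a) s, ([] : List β))) t ∧
        t ≤ (l.length + 1) * (C.eval A + B.eval A + 1) := by
    intro A a l
    induction l with
    | nil =>
      intro s hA
      obtain ⟨t, ht, ht'⟩ := hc (a, s, [])
      have h1 := hA [] (List.prefix_refl _)
      have h2 : (enc F (a, s, ([] : List β))).size ≤ A := by
        simp only [size_enc_pair]; simp only [List.foldl_nil] at h1; omega
      refine ⟨_, .loopDone ht, ?_⟩
      have := eval_mono C h2
      simp only [List.length_nil]
      omega
    | cons b l ih =>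
      intro s hA
      obtain ⟨t, ht, ht'⟩ := hc (a, s, b :: l)
      have h1 := hA [] (List.nil_prefix)
      have h2 : (enc F (a, s, b :: l)).size ≤ A := by
        simp only [size_enc_pair]; simp only [List.foldl_nil] at h1; omega
      obtain ⟨w, hw, hw'⟩ := hbody (a, s, b, l)
      obtain ⟨v, hv, hv'⟩ := ih (g a s b) fun l' hl' => by
        have := hA (b :: l') (by simpa using hl')
        rw [size_enc_cons, List.foldl_cons] at this
        omega
      refine ⟨_, .loopStep ht (by simp [enc_true]) hw hv, ?_⟩
      have e1 := eval_mono C h2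
      have e2 : w ≤ B.eval A := hw'.trans (eval_mono B h2)
      rw [List.length_cons, Nat.succ_mul (l.length + 1)]
      omega
  let A : Polynomial ℕ := Polynomial.X + Q + L + 2
  refine ⟨.seq pi (.seq (.loop pc pb) po),
    I + (L + 1) * (C.comp A + B.comp A + 1) + O.comp A + 2, fun a => ?_⟩
  have hA : A.eval (enc F a).size = (enc F a).size + Q.eval (enc F a).size +
      L.eval (enc F a).size + 2 := by simp [A]
  obtain ⟨t, ht, ht'⟩ := hi a
  obtain ⟨v, hv, hv'⟩ := loop (A.eval (enc F a).size) a (l a) (s a) fun l' hl' => by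
    have := hQ a l' hl'
    have := hL a
    omega
  obtain ⟨w, hw, hw'⟩ := ho (a, (l a).foldl (g a) (s a), ([] : List β))
  refine ⟨_, .seq ht (.seq hv hw), ?_⟩
  have h1 : (l a).length ≤ L.eval (enc F a).size :=
    (length_lt_size_enc (F := F) (l a)).le.trans (hL a)
  have h2 : w ≤ O.eval (A.eval (enc F a).size) := by
    refine hw'.trans (eval_mono O ?_)
    have := hQ a (l a) (List.prefix_refl _)
    have h3 := (Data.size_pos (enc F (l a))).trans (hL a)
    simp only [size_enc_pair, size_enc_nil]
    omega
  have h3 := hv'.trans (Nat.mul_le_mul_right (C.eval (A.eval (enc F a).size) +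
    B.eval (A.eval (enc F a).size) + 1) (Nat.succ_le_succ h1))
  simp only [Polynomial.eval_add, Polynomial.eval_mul, Polynomial.eval_comp, Polynomial.eval_one,
    Nat.succ_eq_add_one, Polynomial.eval_ofNat] at h3 ⊢
  omega

end PolyFn

end PolyFn

section Lists

variable {F : Type u} {α β : Type*} [Code F α] [Code F β]

theorem size_enc_zip_le (l : List α) (l' : List β) :
    (enc F (l.zip l')).size ≤ (enc F l).size + (enc F l').size := by
  induction l generalizing l' with
  | nil => simp only [List.zip_nil_left, size_enc_nil]; omega
  | cons a l ih =>
    cases l' with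
    | nil => simp only [List.zip_nil_right, size_enc_nil]; omega
    | cons b l' =>
      have := ih l'
      simp only [List.zip_cons_cons, size_enc_cons, size_enc_pair]
      omega

theorem size_enc_flatten_le (l : List (List α)) :
    (enc F l.flatten).size ≤ (enc F l).size := by
  induction l with
  | nil => simp [size_enc_nil]
  | cons a l ih =>
    have := size_enc_append (F := F) a l.flatten
    rw [List.flatten_cons, size_enc_cons]
    omega

end Lists

/-! ### Closure under list operations and unary arithmetic. -/

namespace PolyFn

variable {F : Type u} [Field F]
variable {α β γ σ : Type*} [Code F α] [Code F β] [Code F γ] [Code F σ]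

theorem foldl_of_size_le {l : α → List β} {s : α → σ} {g : α → σ → β → σ} (hl : PolyFn F l)
    (hs : PolyFn F s) (hg : PolyFn F fun p : α × σ × β => g p.1 p.2.1 p.2.2) (C : ℕ)
    (hb : ∀ x : σ, (enc F x).size ≤ C) : PolyFn F fun a => (l a).foldl (g a) (s a) :=
  foldl hl hs hg ⟨Polynomial.C C, fun a l' _ => by simpa using hb _⟩

theorem reverse {l : α → List β} (hl : PolyFn F l) : PolyFn F fun a => (l a).reverse := by
  obtain ⟨L, hL⟩ := hl.size_le
  refine (foldl (g := fun _ s b => b :: s) hl (const []) (cons (snd.comp snd) (fst.comp snd))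
    ⟨L, fun a l' h => ?_⟩).of_enc_eq fun a => by simp
  have := size_enc_le_of_prefix (F := F) h
  have := size_enc_reverse (F := F) l'
  have := hL a
  simp
  omega

theorem append {l l' : α → List β} (hl : PolyFn F l) (hl' : PolyFn F l') :
    PolyFn F fun a => l a ++ l' a := by
  obtain ⟨L, hL⟩ := hl.size_le
  obtain ⟨L', hL'⟩ := hl'.size_le
  refine (foldl (g := fun _ s b => b :: s) hl.reverse hl' (cons (snd.comp snd) (fst.comp snd))
    ⟨L + L', fun a r h => ?_⟩).of_enc_eq fun a => by simp
  have h1 := size_enc_le_of_prefix (F := F) h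
  have h2 := size_enc_reverse (F := F) r
  have h3 := size_enc_reverse (F := F) (l a)
  have h4 := size_enc_append (F := F) r.reverse (l' a)
  have := hL a
  have := hL' a
  simp
  omega

theorem map {l : α → List β} {g : α → β → γ} (hl : PolyFn F l)
    (hg : PolyFn F fun p : α × β => g p.1 p.2) : PolyFn F fun a => (l a).map (g a) := by
  obtain ⟨L, hL⟩ := hl.size_le
  obtain ⟨G, hG⟩ := hg.size_le
  have key : ∀ a (r : List β) (s : List γ),
      r.foldl (fun s b => g a b :: s) s = (r.map (g a)).reverse ++ s := by
    intro a r
    induction r with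
    | nil => simp
    | cons b r ih => intro s; simp [ih]
  refine (reverse (foldl (g := fun a s b => g a b :: s) hl (const [])
    (cons (comp₂ hg fst (snd.comp snd)) (fst.comp snd))
    ⟨L * (G.comp (Polynomial.X + L) + 1) + 1, fun a r h => ?_⟩)).of_enc_eq fun a => by
      rw [key]; simp
  rw [key, List.append_nil, size_enc_reverse]
  have h0 := hL a
  have h1 : r.length ≤ L.eval (enc F a).size :=
    (length_lt_size_enc (F := F) r).le.trans ((size_enc_le_of_prefix h).trans h0)
  have h2 : ∀ c ∈ r.map (g a), (enc F c).size ≤ G.eval ((enc F a).size + L.eval (enc F a).size) := by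
    intro c hc
    obtain ⟨b, hb, rfl⟩ := List.mem_map.1 hc
    have h3 := size_enc_le_of_mem (F := F) (h.subset hb)
    refine (hG (a, b)).trans (eval_mono G ?_)
    rw [size_enc_pair]
    omega
  have h3 := size_enc_list_le h2
  rw [List.length_map] at h3
  refine h3.trans ?_
  simp only [Polynomial.eval_add, Polynomial.eval_mul, Polynomial.eval_comp, Polynomial.eval_one,
    Polynomial.eval_X]
  gcongr

theorem flatten {l : α → List (List β)} (hl : PolyFn F l) : PolyFn F fun a => (l a).flatten := by
  obtain ⟨L, hL⟩ := hl.size_le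
  have key : ∀ (r : List (List β)) (s : List β),
      r.foldl (fun s b => s ++ b) s = s ++ r.flatten := by
    intro r
    induction r with
    | nil => simp
    | cons b r ih => intro s; simp [ih]
  refine (foldl (g := fun _ s b => s ++ b) hl (const []) (append (fst.comp snd) (snd.comp snd))
    ⟨L, fun a r h => ?_⟩).of_enc_eq fun a => by rw [key]; simp
  rw [key, List.nil_append]
  exact (size_enc_flatten_le r).trans ((size_enc_le_of_prefix h).trans (hL a))

theorem flatMap {l : α → List β} {g : α → β → List γ} (hl : PolyFn F l)
    (hg : PolyFn F fun p : α × β => g p.1 p.2) : PolyFn F fun a => (l a).flatMap (g a) :=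
  (flatten (map hl hg)).of_enc_eq fun a => by rw [List.flatMap_def]

theorem filter {l : α → List β} {c : α → β → Bool} (hl : PolyFn F l)
    (hc : PolyFn F fun p : α × β => c p.1 p.2) : PolyFn F fun a => (l a).filter (c a) :=
  (flatMap (g := fun a b => bif c a b then [b] else []) hl
    (cond hc (cons snd (const [])) (const []))).of_enc_eq fun a => by
      congr 1
      induction l a with
      | nil => rfl
      | cons b t ih =>
        rw [List.flatMap_cons, ih, List.filter_cons]
        cases c a b <;> rfl

theorem zip {l : α → List β} {l' : α → List γ} (hl : PolyFn F l) (hl' : PolyFn F l') :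
    PolyFn F fun a => (l a).zip (l' a) := by
  obtain ⟨L, hL⟩ := hl.size_le
  obtain ⟨L', hL'⟩ := hl'.size_le
  -- The state holds the unread part of the second list and the pairs found so far, in reverse
  -- order.
  have key : ∀ (r : List β) (s : List γ) (t : List (β × γ)),
      r.foldl (fun (x : List γ × List (β × γ)) b =>
        ChiIMP.listCases x.1 ([], x.2) fun c u => (u, (b, c) :: x.2)) (s, t) =
      (s.drop r.length, (r.zip s).reverse ++ t) := by
    intro r
    induction r with
    | nil => simp
    | cons b r ih =>
      intro s t
      rw [List.foldl_cons]
      cases s with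
      | nil => exact (ih [] t).trans (by simp)
      | cons c s => exact (ih s ((b, c) :: t)).trans (by simp)
  refine (reverse (snd.comp (foldl (l := l) (s := fun a => (l' a, ([] : List (β × γ))))
    (g := fun _ x b => ChiIMP.listCases x.1 ([], x.2) fun c u => (u, (b, c) :: x.2))
    hl (hl'.pair (const [])) ?_ ⟨L + 2 * L' + 1, fun a r h => ?_⟩))).of_enc_eq fun a => ?_
  · refine listCases (F := F) (fst.comp (fst.comp snd)) ((const []).pair (snd.comp (fst.comp snd)))
      (c := fun (p : α × (List γ × List (β × γ)) × β) c u => (u, (p.2.2, c) :: p.2.1.2)) ?_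
    exact (snd.comp snd).pair (cons ((snd.comp (snd.comp fst)).pair (fst.comp snd))
      (snd.comp (fst.comp (snd.comp fst))))
  · rw [key, List.append_nil, size_enc_pair, size_enc_reverse]
    have h1 := size_enc_zip_le (F := F) r (l' a)
    have h2 := size_enc_le_of_prefix (F := F) h
    have h3 := size_enc_le_of_suffix (F := F) (List.drop_suffix r.length (l' a))
    have := hL a
    have := hL' a
    simp
    omega
  · rw [key]; simp

theorem drop {k : α → ℕ} {l : α → List β} (hk : PolyFn F k) (hl : PolyFn F l) :
    PolyFn F fun a => (l a).drop (k a) := by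
  obtain ⟨L, hL⟩ := hl.size_le
  have key : ∀ (r : List Unit) (s : List β),
      r.foldl (fun (x : List β) _ => x.tail) s = s.drop r.length := by
    intro r
    induction r with
    | nil => simp
    | cons b r ih => intro s; simp [ih]
  refine (foldl (l := fun a => List.replicate (k a) ()) (g := fun _ x _ => x.tail)
    (hk.of_enc_eq fun a => (enc_replicate_unit _).symm) hl (tail (fst.comp snd))
    ⟨L, fun a r _ => ?_⟩).of_enc_eq fun a => by rw [key]; simp
  rw [key]
  exact (size_enc_le_of_suffix (List.drop_suffix _ _)).trans (hL a)

theorem replicateUnit {k : α → ℕ} (hk : PolyFn F k) :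
    PolyFn F fun a => List.replicate (k a) () :=
  hk.of_enc_eq fun _ => (enc_replicate_unit _).symm

theorem length {l : α → List β} (hl : PolyFn F l) : PolyFn F fun a => (l a).length :=
  (map (g := fun _ _ => ()) hl (const ())).of_enc_eq fun a => by
    rw [← enc_replicate_unit]; congr 1; simp

theorem nat_add {f g : α → ℕ} (hf : PolyFn F f) (hg : PolyFn F g) :
    PolyFn F fun a => f a + g a :=
  (length (append hf.replicateUnit hg.replicateUnit)).of_enc_eq fun a => by simp

/-- In unary, `f < g` means that something is left after removing `f` units from `g`. -/
theorem nat_lt {f g : α → ℕ} (hf : PolyFn F f) (hg : PolyFn F g) :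
    PolyFn F fun a => decide (f a < g a) :=
  (isCons (drop hf hg.replicateUnit)).of_enc_eq fun a => by
    congr 1
    rw [Bool.eq_iff_iff]
    simp [Nat.sub_eq_zero_iff_le]

theorem nat_eq {f g : α → ℕ} (hf : PolyFn F f) (hg : PolyFn F g) :
    PolyFn F fun a => decide (f a = g a) :=
  (and (not (nat_lt hf hg)) (not (nat_lt hg hf))).of_enc_eq fun a => by
    congr 1
    rw [Bool.eq_iff_iff]
    simp
    omega

theorem range {k : α → ℕ} (hk : PolyFn F k) : PolyFn F fun a => List.range (k a) := by
  obtain ⟨K, hK⟩ := hk.size_le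
  have key : ∀ r : List Unit,
      r.foldl (fun (x : List ℕ) _ => x ++ [x.length]) [] = List.range r.length := by
    intro r
    induction r using List.reverseRecOn with
    | nil => rfl
    | append_singleton r b ih => simp [ih, List.range_succ]
  refine (foldl (g := fun _ (x : List ℕ) _ => x ++ [x.length]) hk.replicateUnit (const [])
    (append (fst.comp snd) (cons (length (fst.comp snd)) (const [])))
    ⟨K * (2 * K + 2) + 1, fun a r h => ?_⟩).of_enc_eq fun a => by rw [key]; simp
  rw [key]
  have h1 : r.length ≤ K.eval (enc F a).size := by
    have h1 := h.length_le
    have h2 := size_enc_nat (F := F) (k a)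
    have := hK a
    rw [List.length_replicate] at h1
    omega
  refine (size_enc_list_le (m := 2 * K.eval (enc F a).size + 1) fun i hi => ?_).trans ?_
  · rw [size_enc_nat]
    have := List.mem_range.1 hi
    omega
  · rw [List.length_range]
    simp only [Polynomial.eval_add, Polynomial.eval_mul, Polynomial.eval_one,
      Polynomial.eval_ofNat]
    exact Nat.add_le_add_right (Nat.mul_le_mul_right _ h1) 1

theorem nat_sum {l : α → List ℕ} (hl : PolyFn F l) : PolyFn F fun a => (l a).sum :=
  (length (flatMap (g := fun _ k => List.replicate k ()) hl (replicateUnit snd))).of_enc_eq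
    fun a => by congr 1; simp [List.length_flatMap]

/-- The accumulator is a field element and so always has size one: there is no growth of
coefficients in this model. -/
theorem sum {l : α → List F} (hl : PolyFn F l) : PolyFn F fun a => (l a).sum :=
  (foldl_of_size_le (g := fun _ s b => b + s) hl.reverse (const (0 : F))
    (add (snd.comp snd) (fst.comp snd)) 1 fun _ => le_rfl).of_enc_eq fun a => by
      rw [List.foldl_reverse]; rfl

theorem foldr_bool {l : α → List β} {s : α → Bool} {g : α → β → Bool → Bool} (hl : PolyFn F l)
    (hs : PolyFn F s) (hg : PolyFn F fun p : α × β × Bool => g p.1 p.2.1 p.2.2) :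
    PolyFn F fun a => (l a).foldr (g a) (s a) :=
  (foldl_of_size_le (g := fun a s b => g a b s) hl.reverse hs
    (hg.comp (f := fun p : α × Bool × β => (p.1, p.2.2, p.2.1))
      (fst.pair ((snd.comp snd).pair (fst.comp snd)))) 3 size_enc_bool).of_enc_eq fun a => by
      rw [List.foldl_reverse]

theorem all {l : α → List β} {c : α → β → Bool} (hl : PolyFn F l)
    (hc : PolyFn F fun p : α × β => c p.1 p.2) : PolyFn F fun a => (l a).all (c a) :=
  (foldr_bool (g := fun a b s => c a b && s) hl (const true)
    (and (comp₂ hc fst (fst.comp snd)) (snd.comp snd))).of_enc_eq fun a => by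
      congr 1
      induction l a with
      | nil => rfl
      | cons b t ih => rw [List.foldr_cons, ih, List.all_cons]

end PolyFn

/-! ### Algorithms on exponent vectors and on lists of terms -/

/-- The exponent vector of the constant monomial in `n` variables. -/
def zeroExp (n : ℕ) : List ℕ := (List.range n).map fun _ => 0

/-- The exponent vector of the variable `i` among `n` variables. -/
def unitExp (n i : ℕ) : List ℕ := (List.range n).map fun j => bif decide (j = i) then 1 else 0

/-- The sum of two exponent vectors. -/
def addExp (e f : List ℕ) : List ℕ := (e.zip f).map fun p => p.1 + p.2

/-- The exponent vectors of total degree at most `k` in `n` variables, with repetitions. -/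
def monomials (n : ℕ) : ℕ → List (List ℕ)
  | 0 => [zeroExp n]
  | k + 1 => monomials n k ++
      (monomials n k).flatMap fun e => (List.range n).map fun i => addExp e (unitExp n i)

/-- Lexicographic comparison of exponent vectors. -/
def lexLt (e f : List ℕ) : Bool :=
  (e.zip f).foldr (fun p b => decide (p.1 < p.2) || (decide (p.1 = p.2) && b)) false

/-- Graded lexicographic comparison of exponent vectors. -/
def degLexLt (e f : List ℕ) : Bool :=
  decide (e.sum < f.sum) || (decide (e.sum = f.sum) && lexLt e f)

/-- Polynomials as lists of terms. -/
abbrev TermList (F : Type u) : Type u := List (F × List ℕ)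

namespace TermList

variable {F : Type u} [Field F]

/-- The product with a monomial. -/
def shift (e : List ℕ) (p : TermList F) : TermList F := p.map fun t => (t.1, addExp e t.2)

/-- The product. -/
def mul (p q : TermList F) : TermList F :=
  p.flatMap fun s => q.map fun t => (s.1 * t.1, addExp s.2 t.2)

/-- The coefficient at an exponent vector. -/
def coeff (p : TermList F) (e : List ℕ) : F :=
  ((p.filter fun t => decide (t.2 = e)).map fun t => t.1).sum

end TermList

/-! ### Algorithms for linear relations. -/

section LinearAlgebra

variable {F : Type u} [Field F]

/-- The inner product of two lists. -/
def dot (a b : List F) : F := ((a.zip b).map fun p => p.1 * p.2).sum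

/-- The unit vectors of length `k`. -/
def unitVectors (F : Type u) [Field F] (k : ℕ) : List (List F) :=
  (List.range k).map fun i => (List.range k).map fun j => bif decide (j = i) then 1 else 0

open Classical in
/-- From generators of a space, compute generators of its intersection with the hyperplane
orthogonal to `φ`. -/
noncomputable def intersectHyperplane (φ : List F) (K : List (List F)) : List (List F) :=
  listCases (K.filter fun q => !decide (dot φ q = 0)) K fun p _ =>
    K.map fun q => (q.zip p).map fun x => x.1 + -1 * (dot φ q * (dot φ p)⁻¹) * x.2

/-- Generators of the space of the linear relations between the members of a list. -/
noncomputable def linearRelations (ps : List (TermList F)) : List (List F) :=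
  (ps.flatten.map fun t => t.2).foldl
    (fun K e => intersectHyperplane (ps.map fun p => p.coeff e) K) (unitVectors F ps.length)

/-- Generators of the space of the linear relations between the members of `gs` modulo the span
of `ws`. -/
noncomputable def relationsMod (gs ws : List (TermList F)) : List (List F) :=
  (linearRelations (gs ++ ws)).map fun c => (gs.zip c).map fun x => x.2

end LinearAlgebra

/-! ### Algorithms for substitution. -/

section Substitution

variable {F : Type u} [Field F]

/-- The exponent vector of a monomial after renaming its variables by the list `Y`. -/
def renameExp (m : ℕ) (Y : List ℕ) (e : List ℕ) : List ℕ :=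
  (List.range m).map fun y => (((e.zip Y).filter fun p => decide (p.2 = y)).map fun p => p.1).sum

/-- The list of the factors, with multiplicities, of the substituted monomial. -/
def substFactors (H : List (TermList F)) (m : ℕ) (s : List (ℕ × List ℕ)) (e : List ℕ) :
    List (TermList F) :=
  (e.zip s).flatMap fun x => (List.replicate x.1 ()).map fun _ =>
    (listCases (H.drop x.2.1) [] fun h _ => h).map fun t => (t.1, renameExp m x.2.2 t.2)

/-- Multiply the first component by the first member of the second component. -/
def mulNext (x : TermList F × List (TermList F)) : TermList F × List (TermList F) :=
  listCases x.2 x fun f r => (x.1.mul f, r)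

/-- Substitution into a term; terms of degree larger than `d` are dropped. -/
def substTerm (d : ℕ) (H : List (TermList F)) (m : ℕ) (s : List (ℕ × List ℕ))
    (t : F × List ℕ) : TermList F :=
  bif ((substFactors H m s t.2).drop d).isEmpty then
    (mulNext^[d] ([(t.1, zeroExp m)], substFactors H m s t.2)).1 else []

/-- Substitution into a polynomial; terms of degree larger than `d` are dropped. -/
def substTerms (d : ℕ) (H : List (TermList F)) (m : ℕ) (s : List (ℕ × List ℕ))
    (p : TermList F) : TermList F :=
  p.flatMap (substTerm d H m s)

end Substitution

/-! ### Algorithms producing the final answers. -/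

section Solutions

variable {F : Type u} [Field F]

/-- All products of monomials of degree at most `k` with members of `G`. -/
def multiples (k n : ℕ) (G : List (TermList F)) : List (TermList F) :=
  (monomials n k).flatMap fun e => G.map fun g => TermList.shift e g

open Classical in
/-- A nontrivial linear relation between the members of `gs` modulo the span of `ws`, or the empty
list. -/
noncomputable def findRelation (gs ws : List (TermList F)) : List F :=
  listCases ((relationsMod gs ws).filter fun c => !c.all fun a => decide (a = 0)) [] fun c _ => c

open Classical in
/-- Polynomials whose leading monomial is the exponent vector `x.1`, obtained from relations
between `x.2` and the second components of the smaller members of `ps` modulo the span of `ws`. -/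
noncomputable def withLeading (ps : List (List ℕ × TermList F)) (ws : List (TermList F))
    (x : List ℕ × TermList F) : List (TermList F) :=
  ((relationsMod (x.2 :: (ps.filter fun y => degLexLt y.1 x.1).map fun y => y.2) ws).filter
    fun c => listCases c false fun a _ => !decide (a = 0)).map
    fun c => c.zip (x.1 :: (ps.filter fun y => degLexLt y.1 x.1).map fun y => y.1)

end Solutions

/-! ### Running times of these algorithms. -/

namespace PolyFn

variable {F : Type u} [Field F]
variable {α β γ : Type*} [Code F α] [Code F β] [Code F γ]

theorem nat_list_eq {f g : α → List ℕ} (hf : PolyFn F f) (hg : PolyFn F g) :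
    PolyFn F fun a => decide (f a = g a) :=
  (and (nat_eq (length hf) (length hg)) (all (c := fun _ p => decide (p.1 = p.2)) (zip hf hg)
    (nat_eq (fst.comp snd) (snd.comp snd)))).of_enc_eq fun a => by
      congr 1
      rw [Bool.eq_iff_iff]
      simp only [Bool.and_eq_true, decide_eq_true_eq]
      generalize f a = l
      generalize g a = l'
      induction l generalizing l' with
      | nil => cases l' <;> simp
      | cons x l ih =>
        cases l' with
        | nil => simp
        | cons y l' =>
          have := ih l'
          simp only [List.length_cons, List.zip_cons_cons, List.all_cons, Bool.and_eq_true,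
            decide_eq_true_eq, List.cons.injEq, Nat.succ_inj]
          tauto

theorem zeroExp {n : α → ℕ} (hn : PolyFn F n) : PolyFn F fun a => ChiIMP.zeroExp (n a) :=
  map (range hn) (const 0)

theorem unitExp {n i : α → ℕ} (hn : PolyFn F n) (hi : PolyFn F i) :
    PolyFn F fun a => ChiIMP.unitExp (n a) (i a) :=
  map (range hn) (cond (nat_eq snd (hi.comp fst)) (const 1) (const 0))

theorem addExp {e f : α → List ℕ} (he : PolyFn F e) (hf : PolyFn F f) :
    PolyFn F fun a => ChiIMP.addExp (e a) (f a) :=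
  map (zip he hf) (nat_add (fst.comp snd) (snd.comp snd))

/-- The recursion on `k` happens outside the machine: there is one program, with its own polynomial
bound, for each fixed `k`. -/
theorem monomials {n : α → ℕ} (hn : PolyFn F n) (k : ℕ) :
    PolyFn F fun a => ChiIMP.monomials (n a) k := by
  induction k with
  | zero => exact cons (zeroExp hn) (const [])
  | succ k ih =>
    exact append ih (flatMap ih (map (range (hn.comp fst))
      (addExp (snd.comp fst) (unitExp (hn.comp (fst.comp fst)) snd))))

theorem lexLt {e f : α → List ℕ} (he : PolyFn F e) (hf : PolyFn F f) :
    PolyFn F fun a => ChiIMP.lexLt (e a) (f a) :=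
  foldr_bool (g := fun _ (p : ℕ × ℕ) b => decide (p.1 < p.2) || (decide (p.1 = p.2) && b)) (zip he hf)
    (const false)
    (or (nat_lt (fst.comp (fst.comp snd)) (snd.comp (fst.comp snd)))
      (and (nat_eq (fst.comp (fst.comp snd)) (snd.comp (fst.comp snd))) (snd.comp snd)))

theorem degLexLt {e f : α → List ℕ} (he : PolyFn F e) (hf : PolyFn F f) :
    PolyFn F fun a => ChiIMP.degLexLt (e a) (f a) :=
  or (nat_lt (nat_sum he) (nat_sum hf))
    (and (nat_eq (nat_sum he) (nat_sum hf)) (lexLt he hf))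

theorem shift {e : α → List ℕ} {p : α → TermList F} (he : PolyFn F e) (hp : PolyFn F p) :
    PolyFn F fun a => (p a).shift (e a) :=
  map hp (pair (fst.comp snd) (addExp (he.comp fst) (snd.comp snd)))

theorem termList_mul {p q : α → TermList F} (hp : PolyFn F p) (hq : PolyFn F q) :
    PolyFn F fun a => (p a).mul (q a) :=
  flatMap hp (map (hq.comp fst) (pair (mul (fst.comp (snd.comp fst)) (fst.comp snd))
    (addExp (snd.comp (snd.comp fst)) (snd.comp snd))))

theorem coeff {p : α → TermList F} {e : α → List ℕ} (hp : PolyFn F p) (he : PolyFn F e) :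
    PolyFn F fun a => (p a).coeff (e a) :=
  sum (map (filter hp (nat_list_eq (snd.comp snd) (he.comp fst))) (fst.comp snd))

theorem dot {u v : α → List F} (hu : PolyFn F u) (hv : PolyFn F v) :
    PolyFn F fun a => ChiIMP.dot (u a) (v a) :=
  sum (map (zip hu hv) (mul (fst.comp snd) (snd.comp snd)))

theorem unitVectors {k : α → ℕ} (hk : PolyFn F k) :
    PolyFn F fun a => ChiIMP.unitVectors F (k a) :=
  map (range hk) (map (range (hk.comp fst))
    (cond (nat_eq snd (snd.comp fst)) (const 1) (const 0)))

theorem intersectHyperplane {φ : α → List F} {K : α → List (List F)} (hφ : PolyFn F φ)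
    (hK : PolyFn F K) : PolyFn F fun a => ChiIMP.intersectHyperplane (φ a) (K a) := by
  classical
  refine listCases (F := F) (filter (c := fun a q => !decide (ChiIMP.dot (φ a) q = 0)) hK (not (isZero (dot (hφ.comp fst) snd)))) hK
    (c := fun a p _ => (K a).map fun q => (q.zip p).map fun x =>
      x.1 + -1 * (ChiIMP.dot (φ a) q * (ChiIMP.dot (φ a) p)⁻¹) * x.2) ?_
  refine map (hK.comp fst) (map (zip snd (fst.comp (snd.comp fst)))
    (add (fst.comp snd) (mul (mul (const (-1)) (mul (dot ?_ ?_) (inv (dot ?_ ?_))))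
      (snd.comp snd))))
  · exact hφ.comp (fst.comp (fst.comp fst))
  · exact snd.comp fst
  · exact hφ.comp (fst.comp (fst.comp fst))
  · exact fst.comp (snd.comp (fst.comp fst))

end PolyFn

section LinearAlgebra

variable {F : Type u} [Field F]

theorem length_unitVectors (k : ℕ) : (unitVectors F k).length = k := by simp [unitVectors]

theorem length_of_mem_unitVectors {k : ℕ} {v : List F} (h : v ∈ unitVectors F k) :
    v.length = k := by
  obtain ⟨i, -, rfl⟩ := List.mem_map.1 h
  simp

/-- The pivot is not removed but stays in the list as the zero vector. A constant number of
generators is all that the size bound needs. -/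
theorem length_intersectHyperplane (φ : List F) (K : List (List F)) :
    (intersectHyperplane φ K).length = K.length := by
  unfold intersectHyperplane listCases
  split <;> simp

theorem length_of_mem_intersectHyperplane {φ : List F} {K : List (List F)} {k : ℕ}
    (hK : ∀ q ∈ K, q.length = k) : ∀ q ∈ intersectHyperplane φ K, q.length = k := by
  classical
  intro q hq
  unfold intersectHyperplane listCases at hq
  split at hq
  · exact hK q hq
  · next p t h =>
    have hp : p ∈ K := List.mem_of_mem_filter (h ▸ List.mem_cons_self)
    obtain ⟨r, hr, rfl⟩ := List.mem_map.1 hq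
    simp [hK r hr, hK p hp]

theorem length_foldl_intersectHyperplane {β : Type*} (φ : β → List F) (l : List β)
    (K : List (List F)) (k : ℕ) (hK : ∀ q ∈ K, q.length = k) :
    (l.foldl (fun K e => intersectHyperplane (φ e) K) K).length = K.length ∧
      ∀ q ∈ l.foldl (fun K e => intersectHyperplane (φ e) K) K, q.length = k := by
  induction l generalizing K with
  | nil => exact ⟨rfl, hK⟩
  | cons b l ih =>
    have := ih _ (length_of_mem_intersectHyperplane (φ := φ b) hK)
    rwa [length_intersectHyperplane] at this

end LinearAlgebra

namespace PolyFn

variable {F : Type u} [Field F]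
variable {α β γ : Type*} [Code F α] [Code F β] [Code F γ]

/-- At every stage there are as many generators as there are polynomials, each a list of that same
length with entries of size one. The accumulator is therefore quadratically bounded in the size of
the list of polynomials. -/
theorem linearRelations {ps : α → List (TermList F)} (hp : PolyFn F ps) :
    PolyFn F fun a => ChiIMP.linearRelations (ps a) := by
  obtain ⟨P, hP⟩ := hp.size_le
  refine foldl (g := fun a K e => ChiIMP.intersectHyperplane ((ps a).map fun p => p.coeff e) K)
    (map (flatten hp) (snd.comp snd)) (unitVectors (length hp))
    (intersectHyperplane (map (hp.comp fst) (coeff snd (snd.comp (snd.comp fst))))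
      (fst.comp snd)) ⟨P * (P * 2 + 1 + 1) + 1, fun a l _ => ?_⟩
  obtain ⟨h1, h2⟩ := length_foldl_intersectHyperplane
    (fun e => (ps a).map fun p => p.coeff e) l (ChiIMP.unitVectors F (ps a).length) (ps a).length
    fun _ => length_of_mem_unitVectors
  have h3 := (length_lt_size_enc (F := F) (ps a)).le.trans (hP a)
  rw [length_unitVectors] at h1
  refine (size_enc_list_le (m := P.eval (enc F a).size * 2 + 1) fun q hq => ?_).trans ?_
  · refine (size_enc_list_le (m := 1) fun x _ => le_rfl).trans ?_
    rw [h2 q hq]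
    omega
  · rw [h1]
    simp only [Polynomial.eval_add, Polynomial.eval_mul, Polynomial.eval_one,
      Polynomial.eval_ofNat]
    exact Nat.add_le_add_right (Nat.mul_le_mul_right _ h3) 1

theorem relationsMod {gs ws : α → List (TermList F)} (hg : PolyFn F gs) (hw : PolyFn F ws) :
    PolyFn F fun a => ChiIMP.relationsMod (gs a) (ws a) :=
  map (linearRelations (append hg hw)) (map (zip (hg.comp fst) snd) (snd.comp snd))

theorem renameExp {m : α → ℕ} {Y e : α → List ℕ} (hm : PolyFn F m) (hY : PolyFn F Y)
    (he : PolyFn F e) : PolyFn F fun a => ChiIMP.renameExp (m a) (Y a) (e a) :=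
  map (range hm) (nat_sum (map (filter (zip (he.comp fst) (hY.comp fst))
    (nat_eq (snd.comp snd) (snd.comp fst))) (fst.comp snd)))

theorem substFactors (H : List (TermList F)) {m : α → ℕ} {s : α → List (ℕ × List ℕ)}
    {e : α → List ℕ} (hm : PolyFn F m) (hs : PolyFn F s) (he : PolyFn F e) :
    PolyFn F fun a => ChiIMP.substFactors H (m a) (s a) (e a) := by
  refine flatMap (zip he hs) (map (replicateUnit (fst.comp snd)) (map (listCases (F := F)
    (c := fun _ h _ => h)
    (drop (fst.comp (snd.comp (snd.comp fst))) (const H)) (const []) (fst.comp snd))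
    (pair (fst.comp snd) (renameExp ?_ ?_ (snd.comp snd)))))
  · exact hm.comp (fst.comp (fst.comp fst))
  · exact snd.comp (snd.comp (snd.comp (fst.comp fst)))

theorem mulNext {x : α → TermList F × List (TermList F)} (hx : PolyFn F x) :
    PolyFn F fun a => ChiIMP.mulNext (x a) :=
  listCases (F := F) (c := fun a f r => ((x a).1.mul f, r)) (snd.comp hx) hx
    (pair (termList_mul (fst.comp (hx.comp fst)) (fst.comp snd)) (snd.comp snd))

theorem iterate {f : α → α} (hf : PolyFn F f) (k : ℕ) : PolyFn F fun a => f^[k] a := by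
  induction k with
  | zero => exact id
  | succ k ih => exact ih.comp hf

/-- The table `H` is a constant of the program, and for fixed `d` a product of at most `d` factors
is a fixed number of polynomial time multiplications. A product of unboundedly many factors could
have exponentially many terms. -/
theorem substTerms (d : ℕ) (H : List (TermList F)) {m : α → ℕ} {s : α → List (ℕ × List ℕ)}
    {p : α → TermList F} (hm : PolyFn F m) (hs : PolyFn F s) (hp : PolyFn F p) :
    PolyFn F fun a => ChiIMP.substTerms d H (m a) (s a) (p a) := by
  have h : PolyFn F fun x : α × F × List ℕ => ChiIMP.substFactors H (m x.1) (s x.1) x.2.2 :=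
    substFactors H (hm.comp fst) (hs.comp fst) (snd.comp snd)
  exact flatMap hp (cond (isEmpty (drop (const d) h))
    (fst.comp ((iterate (mulNext PolyFn.id) d).comp
      (pair (cons (pair (fst.comp snd) (zeroExp (hm.comp fst))) (const [])) h))) (const []))

theorem multiples (k : ℕ) {n : α → ℕ} {G : α → List (TermList F)} (hn : PolyFn F n)
    (hG : PolyFn F G) : PolyFn F fun a => ChiIMP.multiples k (n a) (G a) :=
  flatMap (monomials hn k) (map (hG.comp fst) (shift (snd.comp fst) snd))

theorem findRelation {gs ws : α → List (TermList F)} (hg : PolyFn F gs) (hw : PolyFn F ws) :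
    PolyFn F fun a => ChiIMP.findRelation (gs a) (ws a) :=
  listCases (F := F) (c := fun _ c _ => c) (filter (relationsMod hg hw)
    (not (all snd (isZero snd)))) (const []) (fst.comp snd)

theorem withLeading {ps : α → List (List ℕ × TermList F)} {ws : α → List (TermList F)}
    {x : α → List ℕ × TermList F} (hp : PolyFn F ps) (hw : PolyFn F ws) (hx : PolyFn F x) :
    PolyFn F fun a => ChiIMP.withLeading (ps a) (ws a) (x a) := by
  classical
  have h : PolyFn F fun a => (ps a).filter fun y => ChiIMP.degLexLt y.1 (x a).1 :=
    filter hp (degLexLt (fst.comp snd) (fst.comp (hx.comp fst)))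
  exact map (filter (c := fun _ c => ChiIMP.listCases c false fun a _ => !decide (a = 0))
    (relationsMod (cons (snd.comp hx) (map (g := fun _ y => y.2) h (snd.comp snd))) hw)
    (listCases (F := F) (c := fun _ a _ => !decide (a = 0)) snd (const false)
      (not (isZero (fst.comp snd)))))
    (zip snd (cons (fst.comp (hx.comp fst))
      (map (g := fun _ y => y.1) (h.comp fst) (fst.comp snd))))

end PolyFn

/-! ### Correctness of the linear algebra -/

section Lincomb

variable {F : Type u} [Field F] {M N : Type*} [AddCommGroup M] [Module F M]
  [AddCommGroup N] [Module F N]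

/-- The linear combination of `vs` with coefficients `c`. -/
def lincomb (c : List F) (vs : List M) : M := (List.zipWith (fun a v => a • v) c vs).sum

@[simp] theorem lincomb_nil (c : List F) : lincomb c ([] : List M) = 0 := by simp [lincomb]

@[simp] theorem nil_lincomb (vs : List M) : lincomb ([] : List F) vs = 0 := by simp [lincomb]

@[simp] theorem lincomb_cons (a : F) (c : List F) (v : M) (vs : List M) :
    lincomb (a :: c) (v :: vs) = a • v + lincomb c vs := by simp [lincomb]

theorem lincomb_append {c : List F} {vs : List M} (h : c.length = vs.length) (c' : List F)
    (vs' : List M) : lincomb (c ++ c') (vs ++ vs') = lincomb c vs + lincomb c' vs' := by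
  simp [lincomb, List.zipWith_append h]

theorem map_lincomb (f : M →ₗ[F] N) (c : List F) (vs : List M) :
    f (lincomb c vs) = lincomb c (vs.map f) := by
  induction c generalizing vs with
  | nil => simp
  | cons a c ih => cases vs <;> simp [ih]

theorem lincomb_mem {S : Submodule F M} (c : List F) {vs : List M} (h : ∀ v ∈ vs, v ∈ S) :
    lincomb c vs ∈ S := by
  induction c generalizing vs with
  | nil => simp
  | cons a c ih =>
    cases vs with
    | nil => simp
    | cons v vs =>
      rw [lincomb_cons]
      exact S.add_mem (S.smul_mem _ (h _ List.mem_cons_self))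
        (ih fun w hw => h w (List.mem_cons_of_mem _ hw))

theorem exists_lincomb_of_mem_span {vs : List M} {v : M} (h : v ∈ Submodule.span F {w | w ∈ vs}) :
    ∃ c : List F, c.length = vs.length ∧ lincomb c vs = v := by
  induction vs generalizing v with
  | nil =>
    have : {w | w ∈ ([] : List M)} = (∅ : Set M) := by ext; simp
    rw [this, Submodule.span_empty, Submodule.mem_bot] at h
    exact ⟨[], rfl, by simp [h]⟩
  | cons w vs ih =>
    have : {x | x ∈ w :: vs} = insert w {x | x ∈ vs} := by ext; simp
    rw [this, Submodule.mem_span_insert] at h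
    obtain ⟨a, z, hz, rfl⟩ := h
    obtain ⟨c, hc, rfl⟩ := ih hz
    exact ⟨a :: c, by simp [hc], by simp⟩

/-- The vector given by a list. -/
def toVec (k : ℕ) (c : List F) : Fin k → F := fun i => c.getD i 0

theorem lincomb_eq_sum {k : ℕ} {c : List F} (hc : c.length = k) (vs : List M) :
    lincomb c vs = ∑ i : Fin k, toVec k c i • vs.getD i 0 := by
  subst hc
  induction c generalizing vs with
  | nil => simp
  | cons a c ih =>
    cases vs with
    | nil => simp
    | cons v vs =>
      rw [lincomb_cons, ih vs]
      simp [Fin.sum_univ_succ, toVec]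

theorem dot_eq_lincomb (φ c : List F) : dot φ c = lincomb c φ := by
  unfold dot lincomb
  rw [List.zip, List.map_zipWith, List.zipWith_comm]
  simp only [smul_eq_mul, mul_comm]

theorem dot_eq_sum {k : ℕ} {c : List F} (φ : List F) (hc : c.length = k) :
    dot φ c = Fintype.linearCombination F (fun i : Fin k => φ.getD i 0) (toVec k c) := by
  rw [dot_eq_lincomb, lincomb_eq_sum hc, Fintype.linearCombination_apply]

end Lincomb

section Kernel

variable {F : Type u} [Field F] {M : Type*} [AddCommGroup M] [Module F M]

/-- `T` is the projection onto `ker φ` along `p`: it preserves `S` because `p ∈ S`, and it fixes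
`ker φ` pointwise. -/
theorem map_projection_eq_inf_ker (S : Submodule F M) (φ : M →ₗ[F] F) {p : M} (hp : p ∈ S)
    (hφ : φ p ≠ 0) (T : M →ₗ[F] M) (hT : ∀ x, T x = x + (-1 * (φ x * (φ p)⁻¹)) • p) :
    S.map T = S ⊓ LinearMap.ker φ := by
  ext x
  simp only [Submodule.mem_map, Submodule.mem_inf, LinearMap.mem_ker]
  constructor
  · rintro ⟨y, hy, rfl⟩
    rw [hT]
    refine ⟨S.add_mem hy (S.smul_mem _ hp), ?_⟩
    simp [hφ]
  · rintro ⟨h1, h2⟩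
    exact ⟨x, h1, by rw [hT, h2]; simp⟩

/-- The space spanned by lists of length `k`. -/
def listSpan (k : ℕ) (K : List (List F)) : Submodule F (Fin k → F) :=
  Submodule.span F (toVec k '' {q | q ∈ K})

/-- Either all generators lie in the hyperplane already, or the first one that does not serves as
the pivot `p` of a projection, which is applied to all generators. -/
theorem listSpan_intersectHyperplane {k : ℕ} (φ : List F) {K : List (List F)}
    (hK : ∀ q ∈ K, q.length = k) :
    listSpan k (intersectHyperplane φ K) = listSpan k K ⊓
      LinearMap.ker (Fintype.linearCombination F fun i : Fin k => φ.getD i 0) := by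
  classical
  set L := Fintype.linearCombination F fun i : Fin k => φ.getD i 0
  unfold intersectHyperplane listCases
  split
  · next h =>
    rw [eq_comm, inf_eq_left]
    refine Submodule.span_le.2 ?_
    rintro _ ⟨q, hq, rfl⟩
    have := List.filter_eq_nil_iff.1 h q hq
    simp only [Bool.not_eq_true', decide_eq_false_iff_not, not_not] at this
    rwa [dot_eq_sum φ (hK q hq)] at this
  · next p t h =>
    have h' : p ∈ K.filter fun q => !decide (dot φ q = 0) := h ▸ List.mem_cons_self
    rw [List.mem_filter] at h'
    obtain ⟨hp, hpφ⟩ := h'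
    simp only [Bool.not_eq_true', decide_eq_false_iff_not, dot_eq_sum φ (hK p hp)] at hpφ
    let T : (Fin k → F) →ₗ[F] (Fin k → F) :=
      LinearMap.id + (-((L (toVec k p))⁻¹ • L)).smulRight (toVec k p)
    have hT : ∀ x, T x = x + (-1 * (L x * (L (toVec k p))⁻¹)) • toVec k p := by
      intro x
      simp [T, mul_comm]
    rw [← map_projection_eq_inf_ker (listSpan k K) L
      (Submodule.subset_span (Set.mem_image_of_mem _ hp)) hpφ T hT, listSpan, listSpan,
      Submodule.map_span]
    congr 1
    ext v
    -- The list operation is `T` in coordinates; equal lengths ensure that the zip truncates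
    -- nothing.
    have key : ∀ q ∈ K, toVec k ((q.zip p).map fun x =>
        x.1 + -1 * (dot φ q * (dot φ p)⁻¹) * x.2) = T (toVec k q) := by
      intro q hq
      ext i
      have h1 : (i : ℕ) < q.length := by rw [hK q hq]; exact i.2
      have h2 : (i : ℕ) < p.length := by rw [hK p hp]; exact i.2
      rw [hT, dot_eq_sum φ (hK q hq), dot_eq_sum φ (hK p hp)]
      simp [toVec, h1, h2, L]
    simp only [Set.mem_image, Set.mem_ofPred_eq, List.mem_map]
    constructor
    · rintro ⟨_, ⟨q, hq, rfl⟩, rfl⟩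
      exact ⟨_, ⟨q, hq, rfl⟩, (key q hq).symm⟩
    · rintro ⟨_, ⟨q, hq, rfl⟩, rfl⟩
      exact ⟨_, ⟨q, hq, rfl⟩, key q hq⟩

theorem listSpan_unitVectors (k : ℕ) : listSpan k (unitVectors F k) = ⊤ := by
  rw [eq_top_iff]
  intro c _
  rw [pi_eq_sum_univ' c]
  refine Submodule.sum_mem _ fun i _ => Submodule.smul_mem _ _ (Submodule.subset_span ?_)
  refine ⟨_, List.mem_map.2 ⟨i, List.mem_range.2 i.2, rfl⟩, ?_⟩
  ext j
  simp [toVec, Pi.single_apply, Fin.ext_iff, eq_comm, Bool.cond_decide]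

theorem toVec_mem_listSpan_foldl {β : Type*} {k : ℕ} (φ : β → List F) (l : List β)
    {K : List (List F)} (hK : ∀ q ∈ K, q.length = k) {c : List F} (hc : c.length = k) :
    toVec k c ∈ listSpan k (l.foldl (fun K e => intersectHyperplane (φ e) K) K) ↔
      toVec k c ∈ listSpan k K ∧ ∀ e ∈ l, dot (φ e) c = 0 := by
  induction l generalizing K with
  | nil => simp
  | cons b l ih =>
    rw [List.foldl_cons, ih (length_of_mem_intersectHyperplane hK),
      listSpan_intersectHyperplane _ hK, Submodule.mem_inf, LinearMap.mem_ker,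
      ← dot_eq_sum _ hc, and_assoc, List.forall_mem_cons]

end Kernel

/-! ### Lists of terms and polynomials -/

section ToExp

/-- The exponent given by a list. -/
noncomputable def toExp (n : ℕ) (e : List ℕ) : Fin n →₀ ℕ :=
  Finsupp.equivFunOnFinite.symm fun i => e.getD i 0

theorem toExp_apply (n : ℕ) (e : List ℕ) (i : Fin n) : toExp n e i = e.getD i 0 := rfl

theorem ofFn_toExp {n : ℕ} {e : List ℕ} (he : e.length = n) : List.ofFn (toExp n e) = e := by
  refine List.ext_getElem (by simp [he]) fun i h1 h2 => ?_
  simp [toExp_apply, h2]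

theorem toExp_ofFn {n : ℕ} (s : Fin n → ℕ) :
    toExp n (List.ofFn s) = Finsupp.equivFunOnFinite.symm s := by
  ext i
  simp [toExp_apply]

theorem toExp_ofFn' {n : ℕ} (s : Fin n →₀ ℕ) : toExp n (List.ofFn s) = s := by
  rw [toExp_ofFn]; ext i; rfl

theorem toExp_injOn {n : ℕ} {e f : List ℕ} (he : e.length = n) (hf : f.length = n)
    (h : toExp n e = toExp n f) : e = f := by
  rw [← ofFn_toExp he, h, ofFn_toExp hf]

theorem length_zeroExp (n : ℕ) : (zeroExp n).length = n := by simp [zeroExp]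

theorem toExp_zeroExp (n : ℕ) : toExp n (zeroExp n) = 0 := by
  ext i
  simp [toExp_apply, zeroExp]

theorem length_unitExp (n i : ℕ) : (unitExp n i).length = n := by simp [unitExp]

theorem toExp_unitExp (n : ℕ) (i : Fin n) : toExp n (unitExp n i) = Finsupp.single i 1 := by
  ext j
  simp [toExp_apply, unitExp, Finsupp.single_apply, Fin.ext_iff, eq_comm, Bool.cond_decide]

theorem length_addExp {n : ℕ} {e f : List ℕ} (he : e.length = n) (hf : f.length = n) :
    (addExp e f).length = n := by simp [addExp, he, hf]

theorem toExp_addExp {n : ℕ} {e f : List ℕ} (he : e.length = n) (hf : f.length = n) :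
    toExp n (addExp e f) = toExp n e + toExp n f := by
  ext i
  have h1 : (i : ℕ) < e.length := he ▸ i.2
  have h2 : (i : ℕ) < f.length := hf ▸ i.2
  simp [toExp_apply, addExp, h1, h2]

theorem sum_eq_degree {n : ℕ} {e : List ℕ} (he : e.length = n) : e.sum = (toExp n e).degree := by
  conv_lhs => rw [← ofFn_toExp he]
  rw [List.sum_ofFn, Finsupp.degree_eq_sum]

theorem length_of_mem_monomials {n k : ℕ} {e : List ℕ} (he : e ∈ monomials n k) :
    e.length = n := by
  induction k generalizing e with
  | zero => rw [monomials, List.mem_singleton] at he; rw [he, length_zeroExp]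
  | succ k ih =>
    rw [monomials, List.mem_append, List.mem_flatMap] at he
    rcases he with he | ⟨f, hf, he⟩
    · exact ih he
    · obtain ⟨i, -, rfl⟩ := List.mem_map.1 he
      exact length_addExp (ih hf) (length_unitExp _ _)

theorem degree_le_of_mem_monomials {n k : ℕ} {e : List ℕ} (he : e ∈ monomials n k) :
    (toExp n e).degree ≤ k := by
  induction k generalizing e with
  | zero => rw [monomials, List.mem_singleton] at he; simp [he, toExp_zeroExp]
  | succ k ih =>
    rw [monomials, List.mem_append, List.mem_flatMap] at he
    rcases he with he | ⟨f, hf, he⟩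
    · exact (ih he).trans k.le_succ
    · obtain ⟨i, hi, rfl⟩ := List.mem_map.1 he
      have := toExp_unitExp n ⟨i, List.mem_range.1 hi⟩
      rw [toExp_addExp (length_of_mem_monomials hf) (length_unitExp _ _), this,
        map_add, Finsupp.degree_single]
      exact Nat.succ_le_succ (ih hf)

theorem exists_mem_monomials {n k : ℕ} (s : Fin n →₀ ℕ) (hs : s.degree ≤ k) :
    ∃ e ∈ monomials n k, toExp n e = s := by
  induction k generalizing s with
  | zero =>
    refine ⟨zeroExp n, by simp [monomials], ?_⟩
    rw [toExp_zeroExp, eq_comm, ← Finsupp.degree_eq_zero_iff]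
    omega
  | succ k ih =>
    by_cases h : s = 0
    · obtain ⟨e, he, h'⟩ := ih s (by simp [h])
      exact ⟨e, by rw [monomials]; exact List.mem_append_left _ he, h'⟩
    · obtain ⟨i, hi⟩ := Finsupp.ne_iff.1 h
      have hle : Finsupp.single i 1 ≤ s := by
        rw [Finsupp.single_le_iff]
        exact Nat.one_le_iff_ne_zero.2 hi
      obtain ⟨t, rfl⟩ := exists_add_of_le hle
      rw [map_add, Finsupp.degree_single] at hs
      obtain ⟨e, he, rfl⟩ := ih t (by omega)
      refine ⟨addExp e (unitExp n i), ?_, ?_⟩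
      · rw [monomials]
        refine List.mem_append_right _ (List.mem_flatMap.2 ⟨e, he, List.mem_map.2 ⟨i, ?_, rfl⟩⟩)
        exact List.mem_range.2 i.2
      · rw [toExp_addExp (length_of_mem_monomials he) (length_unitExp _ _), toExp_unitExp,
          add_comm]

theorem lexLt_ofFn {n : ℕ} (s t : Fin n → ℕ) :
    lexLt (List.ofFn s) (List.ofFn t) = true ↔ ∃ i, (∀ j < i, s j = t j) ∧ s i < t i := by
  induction n with
  | zero => simp [lexLt]
  | succ n ih =>
    have := ih (fun i => s i.succ) fun i => t i.succ
    simp only [lexLt, List.ofFn_succ, List.zip_cons_cons, List.foldr_cons, Bool.or_eq_true,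
      Bool.and_eq_true, decide_eq_true_eq] at this ⊢
    rw [this, Fin.exists_fin_succ]
    simp [Fin.forall_fin_succ, and_assoc, exists_and_left]

/-- Ties in degree are broken at the first position where the vectors differ, in agreement with
variable `0` being the largest. -/
theorem degLexLt_iff {n : ℕ} {e f : List ℕ} (he : e.length = n) (hf : f.length = n) :
    degLexLt e f = true ↔ toDegLex (toExp n e) < toDegLex (toExp n f) := by
  rw [Finsupp.DegLex.lt_iff, ofDegLex_toDegLex, ofDegLex_toDegLex, Finsupp.Lex.lt_iff,
    ← sum_eq_degree he, ← sum_eq_degree hf]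
  have := lexLt_ofFn (toExp n e) (toExp n f)
  rw [ofFn_toExp he, ofFn_toExp hf] at this
  simp [degLexLt, this]

end ToExp

open MvPolynomial

namespace TermList

variable {F : Type u} [Field F]

/-- The polynomial in `n` variables given by a list of terms. -/
noncomputable def toPoly (n : ℕ) (p : TermList F) : MvPolynomial (Fin n) F :=
  (p.map fun t => monomial (toExp n t.2) t.1).sum

/-- All exponent vectors have length `n`. -/
def HasArity (n : ℕ) (p : TermList F) : Prop := ∀ t ∈ p, t.2.length = n

@[simp] theorem toPoly_nil (n : ℕ) : toPoly n ([] : TermList F) = 0 := by simp [toPoly]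

@[simp] theorem toPoly_cons (n : ℕ) (t : F × List ℕ) (p : TermList F) :
    toPoly n (t :: p) = monomial (toExp n t.2) t.1 + toPoly n p := by simp [toPoly]

@[simp] theorem toPoly_append (n : ℕ) (p q : TermList F) :
    toPoly n (p ++ q) = toPoly n p + toPoly n q := by simp [toPoly]

/-- This passes from exponents indexed by `Fin n` to plain lists, whose type does not depend on the
instance; the number of variables survives as the side condition `HasArity`. -/
theorem codesPoly_iff {n : ℕ} {x : Data F} {g : MvPolynomial (Fin n) F} :
    CodesPoly x g ↔ ∃ p : TermList F, p.HasArity n ∧ toPoly n p = g ∧ enc F p = x := by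
  constructor
  · rintro ⟨ts, rfl, rfl⟩
    refine ⟨ts.map fun t => (t.1, List.ofFn t.2), ?_, ?_, ?_⟩
    · intro t ht
      obtain ⟨s, -, rfl⟩ := List.mem_map.1 ht
      simp
    · simp [toPoly, toExp_ofFn, Function.comp_def]
    · rw [enc_list, List.map_map]
      congr 1
      refine List.map_congr_left fun t _ => ?_
      rw [Function.comp_apply, enc_pair, enc_list, List.map_ofFn]
      rfl
  · rintro ⟨p, hp, rfl, rfl⟩
    refine ⟨p.map fun t => (t.1, toExp n t.2), ?_, ?_⟩
    · rw [enc_list, List.map_map]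
      congr 1
      refine List.map_congr_left fun t ht => ?_
      rw [Function.comp_apply, enc_pair, enc_list]
      conv_lhs => rw [← ofFn_toExp (hp t ht), List.map_ofFn]
      rfl
    · rw [toPoly, List.map_map]
      rfl

theorem codesList_codesPoly_iff {n : ℕ} {x : Data F} {l : List (MvPolynomial (Fin n) F)} :
    CodesList CodesPoly x l ↔ ∃ ps : List (TermList F), (∀ p ∈ ps, p.HasArity n) ∧
      ps.map (toPoly n) = l ∧ enc F ps = x := by
  constructor
  · rintro ⟨xs, rfl, h⟩
    induction h with
    | nil => exact ⟨[], by simp, rfl, rfl⟩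
    | cons h _ ih =>
      obtain ⟨p, hp, rfl, rfl⟩ := codesPoly_iff.1 h
      obtain ⟨ps, hps, rfl, h'⟩ := ih
      refine ⟨p :: ps, List.forall_mem_cons.2 ⟨hp, hps⟩, rfl, ?_⟩
      rw [enc_cons, h']
      rfl
  · rintro ⟨ps, hps, rfl, rfl⟩
    refine ⟨ps.map (enc F), rfl, ?_⟩
    rw [List.forall₂_map_left_iff, List.forall₂_map_right_iff, List.forall₂_same]
    exact fun p hp => codesPoly_iff.2 ⟨p, hps p hp, rfl, rfl⟩

theorem HasArity.shift {F : Type u} {n : ℕ} {p : TermList F} (hp : p.HasArity n) {e : List ℕ}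
    (he : e.length = n) : (p.shift e).HasArity n := by
  intro t ht
  obtain ⟨s, hs, rfl⟩ := List.mem_map.1 ht
  exact length_addExp he (hp s hs)

theorem toPoly_shift {n : ℕ} {p : TermList F} (hp : p.HasArity n) {e : List ℕ}
    (he : e.length = n) : toPoly n (p.shift e) = monomial (toExp n e) 1 * toPoly n p := by
  induction p with
  | nil => simp [TermList.shift]
  | cons t p ih =>
    have ih := ih fun s hs => hp s (List.mem_cons_of_mem _ hs)
    have h := hp t List.mem_cons_self
    simp only [TermList.shift, List.map_cons, toPoly_cons] at ih ⊢
    rw [ih, toExp_addExp he h, mul_add, monomial_mul, one_mul]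

theorem HasArity.mul {n : ℕ} {p q : TermList F} (hp : p.HasArity n) (hq : q.HasArity n) :
    (p.mul q).HasArity n := by
  intro t ht
  obtain ⟨s, hs, ht⟩ := List.mem_flatMap.1 ht
  obtain ⟨r, hr, rfl⟩ := List.mem_map.1 ht
  exact length_addExp (hp s hs) (hq r hr)

theorem toPoly_mul {n : ℕ} {p q : TermList F} (hp : p.HasArity n) (hq : q.HasArity n) :
    toPoly n (p.mul q) = toPoly n p * toPoly n q := by
  induction p with
  | nil => simp [TermList.mul]
  | cons t p ih =>
    replace ih := ih fun s hs => hp s (List.mem_cons_of_mem _ hs)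
    have h := hp t List.mem_cons_self
    simp only [TermList.mul, List.flatMap_cons, toPoly_append, toPoly_cons] at ih ⊢
    rw [ih, add_mul]
    congr 1
    clear ih
    induction q with
    | nil => simp
    | cons s q ih =>
      rw [List.map_cons, toPoly_cons, ih fun r hr => hq r (List.mem_cons_of_mem _ hr), toPoly_cons,
        mul_add, monomial_mul, toExp_addExp h (hq s List.mem_cons_self)]

theorem coeff_toPoly {n : ℕ} {p : TermList F} (hp : p.HasArity n) {e : List ℕ}
    (he : e.length = n) : MvPolynomial.coeff (toExp n e) (toPoly n p) = p.coeff e := by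
  induction p with
  | nil => simp [TermList.coeff]
  | cons t p ih =>
    have ih := ih fun s hs => hp s (List.mem_cons_of_mem _ hs)
    have h := hp t List.mem_cons_self
    have h' : toExp n t.2 = toExp n e ↔ t.2 = e := ⟨toExp_injOn h he, fun h => by rw [h]⟩
    rw [toPoly_cons, MvPolynomial.coeff_add, ih, coeff_monomial]
    by_cases ht : t.2 = e <;> simp [TermList.coeff, ht, h']

theorem exists_of_coeff_toPoly_ne_zero {n : ℕ} {p : TermList F} {s : Fin n →₀ ℕ}
    (h : MvPolynomial.coeff s (toPoly n p) ≠ 0) : ∃ t ∈ p, toExp n t.2 = s := by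
  induction p with
  | nil => simp at h
  | cons t p ih =>
    by_cases ht : toExp n t.2 = s
    · exact ⟨t, List.mem_cons_self, ht⟩
    · rw [toPoly_cons, MvPolynomial.coeff_add, coeff_monomial, if_neg ht, zero_add] at h
      obtain ⟨t, h1, h2⟩ := ih h
      exact ⟨t, List.mem_cons_of_mem _ h1, h2⟩

theorem toPoly_zip {n : ℕ} (c : List F) (es : List (List ℕ)) :
    toPoly n (c.zip es) = lincomb c (es.map fun e => monomial (toExp n e) (1 : F)) := by
  induction c generalizing es with
  | nil => simp
  | cons a c ih => cases es <;> simp [ih, smul_monomial]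

end TermList

open TermList

/-! ### Linear relations between polynomials, modulo a span. -/

section Relations

variable {F : Type u} [Field F]

/-- Only exponents written somewhere in the lists can have a nonzero coefficient, so vanishing
amounts to finitely many linear equations in `c` that can be read off the input. -/
theorem lincomb_toPoly_eq_zero_iff {n : ℕ} {ps : List (TermList F)}
    (hps : ∀ p ∈ ps, p.HasArity n) (c : List F) :
    lincomb c (ps.map (toPoly n)) = 0 ↔
      ∀ e ∈ ps.flatten.map fun t => t.2, dot (ps.map fun p => p.coeff e) c = 0 := by
  have key : ∀ e : List ℕ, e.length = n →
      dot (ps.map fun p => p.coeff e) c =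
        MvPolynomial.coeff (toExp n e) (lincomb c (ps.map (toPoly n))) := by
    intro e he
    rw [dot_eq_lincomb]
    have := map_lincomb (MvPolynomial.lcoeff F (toExp n e)) c (ps.map (toPoly n))
    rw [lcoeff_apply] at this
    rw [this, List.map_map]
    congr 1
    exact List.map_congr_left fun p hp => (coeff_toPoly (hps p hp) he).symm
  constructor
  · intro h e he
    obtain ⟨t, ht, rfl⟩ := List.mem_map.1 he
    obtain ⟨p, hp, ht⟩ := List.mem_flatten.1 ht
    rw [key _ (hps p hp t ht), h, MvPolynomial.coeff_zero]
  · intro h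
    ext s
    rw [MvPolynomial.coeff_zero]
    by_contra hs
    have : ∃ p ∈ ps, MvPolynomial.coeff s (toPoly n p) ≠ 0 := by
      by_contra! h'
      refine hs (lincomb_mem (S := LinearMap.ker (MvPolynomial.lcoeff F s)) c fun v hv => ?_)
      obtain ⟨p, hp, rfl⟩ := List.mem_map.1 hv
      exact h' p hp
    obtain ⟨p, hp, h'⟩ := this
    obtain ⟨t, ht, rfl⟩ := exists_of_coeff_toPoly_ne_zero h'
    exact hs (key _ (hps p hp t ht) ▸ h t.2 (List.mem_map_of_mem (List.mem_flatten.2 ⟨p, hp, ht⟩)))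

theorem length_of_mem_linearRelations {ps : List (TermList F)} {c : List F}
    (hc : c ∈ linearRelations ps) : c.length = ps.length :=
  (length_foldl_intersectHyperplane _ _ _ _ fun _ => length_of_mem_unitVectors).2 c hc

theorem toVec_mem_listSpan_linearRelations {n : ℕ} {ps : List (TermList F)}
    (hps : ∀ p ∈ ps, p.HasArity n) {c : List F} (hc : c.length = ps.length) :
    toVec ps.length c ∈ listSpan ps.length (linearRelations ps) ↔
      lincomb c (ps.map (toPoly n)) = 0 := by
  rw [linearRelations, toVec_mem_listSpan_foldl (fun e => ps.map fun p => p.coeff e) _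
    (fun _ => length_of_mem_unitVectors) hc, listSpan_unitVectors,
    lincomb_toPoly_eq_zero_iff hps]
  simp

theorem mem_relationsMod {gs ws : List (TermList F)} {r : List F}
    (hr : r ∈ relationsMod gs ws) :
    ∃ e : List F, r.length = gs.length ∧ r ++ e ∈ linearRelations (gs ++ ws) := by
  obtain ⟨c, hc, rfl⟩ := List.mem_map.1 hr
  have h := length_of_mem_linearRelations hc
  rw [List.length_append] at h
  have h' : (gs.zip c).map (fun x => x.2) = c.take gs.length := by
    refine List.ext_getElem (by simp) fun i h1 h2 => by simp
  refine ⟨c.drop gs.length, by simp; omega, ?_⟩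
  rwa [h', List.take_append_drop]

/-- In a relation between the members of `gs ++ ws`, the part on `gs` is minus a combination of
`ws`. -/
theorem relationsMod_sound {n : ℕ} {gs ws : List (TermList F)} (hg : ∀ p ∈ gs, p.HasArity n)
    (hw : ∀ p ∈ ws, p.HasArity n) {r : List F} (hr : r ∈ relationsMod gs ws) :
    r.length = gs.length ∧
      lincomb r (gs.map (toPoly n)) ∈ Submodule.span F {f | f ∈ ws.map (toPoly n)} := by
  obtain ⟨e, h1, h2⟩ := mem_relationsMod hr
  refine ⟨h1, ?_⟩
  have h3 := (toVec_mem_listSpan_linearRelations (n := n) (fun p hp => (List.mem_append.1 hp).elim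
    (hg p) (hw p)) (length_of_mem_linearRelations h2)).1
    (Submodule.subset_span (Set.mem_image_of_mem _ h2))
  rw [List.map_append, lincomb_append (by simpa using h1)] at h3
  rw [eq_neg_of_add_eq_zero_left h3]
  exact Submodule.neg_mem _ (lincomb_mem e fun v hv => Submodule.subset_span hv)

/-- If all generators vanished at coordinate `i`, so would their span, which contains `c` extended
by coefficients on `ws`. This weak form suffices: an arbitrary `i` yields a nonzero relation, and `i
= 0` a relation with nonzero leading coefficient. -/
theorem relationsMod_complete {n : ℕ} {gs ws : List (TermList F)} (hg : ∀ p ∈ gs, p.HasArity n)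
    (hw : ∀ p ∈ ws, p.HasArity n) {c : List F} (hc : c.length = gs.length)
    (h : lincomb c (gs.map (toPoly n)) ∈ Submodule.span F {f | f ∈ ws.map (toPoly n)})
    (i : ℕ) (hi : c.getD i 0 ≠ 0) : ∃ r ∈ relationsMod gs ws, r.getD i 0 ≠ 0 := by
  by_contra! hr
  have hic : i < c.length := by
    by_contra h'
    exact hi (by simp [not_lt.1 h'])
  obtain ⟨e, he, he'⟩ := exists_lincomb_of_mem_span (Submodule.neg_mem _ h)
  rw [List.length_map] at he
  have h1 : lincomb (c ++ e) ((gs ++ ws).map (toPoly n)) = 0 := by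
    rw [List.map_append, lincomb_append (by simpa using hc), he', add_neg_cancel]
  rw [← toVec_mem_listSpan_linearRelations (fun p hp => (List.mem_append.1 hp).elim
    (hg p) (hw p)) (by simp [hc, he])] at h1
  let j : Fin (gs ++ ws).length := ⟨i, by simp; omega⟩
  have h2 : listSpan (gs ++ ws).length (linearRelations (gs ++ ws)) ≤
      LinearMap.ker (LinearMap.proj (R := F) (φ := fun _ => F) j) := by
    refine Submodule.span_le.2 ?_
    rintro _ ⟨q, hq, rfl⟩
    have h3 := hr _ (List.mem_map.2 ⟨q, hq, rfl⟩)
    have h4 : i < q.length := by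
      rw [length_of_mem_linearRelations hq, List.length_append]; omega
    have h5 : i < gs.length := hc ▸ hic
    have h6 : q[i] = 0 := by simpa [h4, h5] using h3
    simp [toVec, j, h4, h6]
  have h3 := h2 h1
  refine hi ?_
  simpa [toVec, j, hic, List.getElem?_append_left hic] using h3

end Relations

/-! ### Correctness of the substitution -/

theorem sum_map_filter {β : Type*} {M : Type*} [AddCommMonoid M] (l : List β) (c : β → Bool)
    (f : β → M) : ((l.filter c).map f).sum = (l.map fun b => if c b then f b else 0).sum := by
  induction l with
  | nil => rfl
  | cons b l ih =>
    rw [List.filter_cons]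
    split <;> simp_all

theorem zip_ofFn {β γ : Type*} {n : ℕ} (f : Fin n → β) (g : Fin n → γ) :
    (List.ofFn f).zip (List.ofFn g) = List.ofFn fun i => (f i, g i) :=
  List.ext_getElem (by simp) fun i h1 h2 => by simp

theorem length_renameExp (m : ℕ) (Y e : List ℕ) : (renameExp m Y e).length = m := by
  simp [renameExp]

theorem toExp_renameExp {a m : ℕ} (Y : Fin a → Fin m) {e : List ℕ} (he : e.length = a) :
    toExp m (renameExp m (List.ofFn fun j => (Y j : ℕ)) e) =
      Finsupp.mapDomain Y (toExp a e) := by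
  ext y
  rw [Finsupp.mapDomain, Finsupp.sum_fintype _ _ (by simp), Finsupp.finsetSum_apply, toExp_apply]
  conv_lhs => rw [← ofFn_toExp he]
  simp [renameExp, zip_ofFn, sum_map_filter, List.sum_ofFn, Finsupp.single_apply, Fin.ext_iff,
    List.map_ofFn, Function.comp_def]

section

variable {F : Type u} [Field F]

theorem exists_toPoly_eq {n : ℕ} (g : MvPolynomial (Fin n) F) :
    ∃ p : TermList F, p.HasArity n ∧ toPoly n p = g := by
  induction g using MvPolynomial.induction_on' with
  | monomial s a => exact ⟨[(a, List.ofFn s)], by simp [HasArity], by simp [toExp_ofFn']⟩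
  | add f g hf hg =>
    obtain ⟨p, hp, rfl⟩ := hf
    obtain ⟨q, hq, rfl⟩ := hg
    exact ⟨p ++ q, List.forall_mem_append.2 ⟨hp, hq⟩, toPoly_append _ _ _⟩

theorem toPoly_map_renameExp {a m : ℕ} (Y : Fin a → Fin m) {p : TermList F}
    (hp : p.HasArity a) :
    toPoly m (p.map fun t => (t.1, renameExp m (List.ofFn fun j => (Y j : ℕ)) t.2)) =
      rename Y (toPoly a p) := by
  induction p with
  | nil => simp
  | cons t p ih =>
    rw [List.map_cons, toPoly_cons, ih fun s hs => hp s (List.mem_cons_of_mem _ hs), toPoly_cons,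
      map_add, rename_monomial, toExp_renameExp Y (hp t List.mem_cons_self)]

/-- Once the factors are used up, further iterations change nothing, so any number of rounds that is
at least the number of factors will do. -/
theorem iterate_mulNext {m d : ℕ} {p : TermList F} {fs : List (TermList F)} (hp : p.HasArity m)
    (hfs : ∀ f ∈ fs, f.HasArity m) (hd : fs.length ≤ d) :
    (mulNext^[d] (p, fs)).1.HasArity m ∧
      toPoly m (mulNext^[d] (p, fs)).1 = toPoly m p * (fs.map (toPoly m)).prod := by
  induction d generalizing p fs with
  | zero =>
    rw [Nat.le_zero, List.length_eq_zero_iff] at hd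
    simp [hd, hp]
  | succ d ih =>
    rw [Function.iterate_succ_apply]
    cases fs with
    | nil => exact ih hp hfs (Nat.zero_le _)
    | cons f fs =>
      rw [List.forall_mem_cons] at hfs
      have := ih (hp.mul hfs.1) hfs.2 (Nat.succ_le_succ_iff.1 hd)
      rwa [toPoly_mul hp hfs.1, mul_assoc, ← List.prod_cons, ← List.map_cons] at this

variable {D E : Finset F} {S : SubstCollection D E} {n m : ℕ}

/-- The list of numbers that is given by a choice. -/
def Choice.toList (s : Choice S n m) : List (ℕ × List ℕ) :=
  List.ofFn fun x => ((s.idx x : ℕ), List.ofFn fun j => (s.vars x j : ℕ))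

theorem Choice.enc_toList (s : Choice S n m) : enc F s.toList = s.code := by
  rw [toList, code, enc_list, List.map_ofFn]
  congr 2
  ext1 x
  rw [Function.comp_apply, enc_pair, enc_list, List.map_ofFn]
  rfl

/-- `H` lists codes of the interpolating polynomials of `S`. -/
def SubstCollection.IsTable (S : SubstCollection D E) (H : List (TermList F)) : Prop :=
  ∀ i : Fin S.k, ∃ h : TermList F, h.HasArity (S.arity i) ∧ toPoly _ h = S.poly i ∧
    ∃ t, H.drop i = h :: t

theorem SubstCollection.exists_isTable (S : SubstCollection D E) : ∃ H, S.IsTable H := by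
  choose h h1 h2 using fun i => exists_toPoly_eq (S.poly i)
  refine ⟨List.ofFn h, fun i => ⟨h i, h1 i, h2 i, (List.ofFn h).drop (i + 1), ?_⟩⟩
  rw [List.drop_eq_getElem_cons (by simp)]
  simp

/-- The polynomial that is substituted for a variable. -/
noncomputable def Choice.image (s : Choice S n m) (x : Fin n) : MvPolynomial (Fin m) F :=
  rename (s.vars x) (S.poly (s.idx x))

/-- Factors are repeated according to the exponents, so their number is the degree of the monomial.
The degree test in `substTerm` can thus be made on the length of this list. -/
theorem substFactors_spec {H : List (TermList F)} (hH : S.IsTable H) (s : Choice S n m)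
    {e : List ℕ} (he : e.length = n) :
    (substFactors H m s.toList e).length = (toExp n e).degree ∧
      (∀ f ∈ substFactors H m s.toList e, f.HasArity m) ∧
      ((substFactors H m s.toList e).map (toPoly m)).prod = ∏ x, s.image x ^ toExp n e x := by
  choose h h1 h2 t h3 using hH
  have : substFactors H m s.toList e = (List.ofFn fun x =>
      List.replicate (toExp n e x) ((h (s.idx x)).map fun t =>
        (t.1, renameExp m (List.ofFn fun j => (s.vars x j : ℕ)) t.2))).flatten := by
    rw [substFactors, List.flatMap_def]
    conv_lhs => rw [← ofFn_toExp he]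
    rw [Choice.toList, zip_ofFn, List.map_ofFn]
    congr 2
    ext1 x
    simp [h3, listCases]
  rw [this]
  refine ⟨?_, ?_, ?_⟩
  · simp [List.length_flatten, List.map_ofFn, Function.comp_def, List.sum_ofFn,
      Finsupp.degree_eq_sum]
  · intro f hf
    obtain ⟨l, hl, hf⟩ := List.mem_flatten.1 hf
    obtain ⟨x, rfl⟩ := (List.mem_ofFn' _ _).1 hl
    rw [List.eq_of_mem_replicate hf]
    intro t ht
    obtain ⟨u, -, rfl⟩ := List.mem_map.1 ht
    exact length_renameExp _ _ _
  · rw [List.map_flatten, List.prod_flatten, List.map_map, List.map_ofFn, List.prod_ofFn]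
    refine Finset.prod_congr rfl fun x _ => ?_
    simp [toPoly_map_renameExp _ (h1 _), h2, Choice.image]

theorem Choice.subst_monomial (s : Choice S n m) (e : Fin n →₀ ℕ) (a : F) :
    s.subst (monomial e a) = C a * ∏ x, s.image x ^ e x := by
  rw [subst, bind₁_monomial]
  congr 1
  refine Finset.prod_subset (Finset.subset_univ _) fun x _ hx => ?_
  rw [Finsupp.notMem_support_iff.1 hx, pow_zero]

theorem substTerm_spec {H : List (TermList F)} (hH : S.IsTable H) (s : Choice S n m) (d : ℕ)
    {t : F × List ℕ} (ht : t.2.length = n) :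
    (substTerm d H m s.toList t).HasArity m ∧ toPoly m (substTerm d H m s.toList t) =
      if (toExp n t.2).degree ≤ d then s.subst (monomial (toExp n t.2) t.1) else 0 := by
  obtain ⟨h1, h2, h3⟩ := substFactors_spec hH s ht
  have h4 : ((substFactors H m s.toList t.2).drop d).isEmpty = decide ((toExp n t.2).degree ≤ d) := by
    rw [Bool.eq_iff_iff, ← h1]
    simp
  rw [substTerm, h4]
  by_cases h : (toExp n t.2).degree ≤ d
  · have hz : HasArity m [(t.1, zeroExp m)] := by simp [HasArity, length_zeroExp]
    obtain ⟨h5, h6⟩ := iterate_mulNext hz h2 (h1.trans_le h)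
    rw [decide_eq_true h, cond_true, if_pos h]
    refine ⟨h5, ?_⟩
    rw [h6, h3, s.subst_monomial]
    simp [toExp_zeroExp]
  · simp [h, HasArity]

/-- A code of a polynomial of degree at most `d` may contain terms of larger degree that cancel. At
each such exponent the terms sum to zero, so all of them can be discarded. -/
theorem toPoly_filter_degree_le {p : TermList F} {d : ℕ} (hd : (toPoly n p).totalDegree ≤ d) :
    toPoly n (p.filter fun t => decide ((toExp n t.2).degree ≤ d)) = toPoly n p := by
  have key : ∀ s : Fin n →₀ ℕ,
      MvPolynomial.coeff s (toPoly n (p.filter fun t => decide ((toExp n t.2).degree ≤ d))) =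
        if s.degree ≤ d then MvPolynomial.coeff s (toPoly n p) else 0 := by
    intro s
    clear hd
    induction p with
    | nil => simp
    | cons t p ih =>
      rw [List.filter_cons]
      by_cases ht : (toExp n t.2).degree ≤ d
      · simp only [ht, decide_true, if_true, toPoly_cons, MvPolynomial.coeff_add, ih]
        split
        · rfl
        · next h =>
          rw [coeff_monomial, if_neg, add_zero]
          rintro rfl
          exact h ht
      · simp only [ht, decide_false, toPoly_cons, MvPolynomial.coeff_add]
        rw [if_neg (by simp), ih]
        split
        · next h =>
          rw [coeff_monomial, if_neg, zero_add]
          rintro rfl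
          exact ht h
        · rfl
  ext s
  rw [key]
  split
  · rfl
  · next h =>
    rw [eq_comm]
    refine coeff_eq_zero_of_totalDegree_lt ?_
    have h' : s.degree = ∑ i ∈ s.support, s i := rfl
    omega

theorem substTerms_spec {H : List (TermList F)} (hH : S.IsTable H) (s : Choice S n m) {d : ℕ}
    {p : TermList F} (hp : p.HasArity n) (hd : (toPoly n p).totalDegree ≤ d) :
    (substTerms d H m s.toList p).HasArity m ∧
      toPoly m (substTerms d H m s.toList p) = s.subst (toPoly n p) := by
  -- After removing the cancelling terms on the right the claim is additive over the list, without
  -- any assumption on the degree.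
  rw [← toPoly_filter_degree_le hd]
  clear hd
  induction p with
  | nil => simp [substTerms, HasArity, Choice.subst]
  | cons t p ih =>
    obtain ⟨h1, h2⟩ := ih fun s hs => hp s (List.mem_cons_of_mem _ hs)
    obtain ⟨h3, h4⟩ := substTerm_spec hH s d (hp t List.mem_cons_self)
    rw [substTerms] at h1 h2 ⊢
    rw [List.flatMap_cons]
    refine ⟨List.forall_mem_append.2 ⟨h3, h1⟩, ?_⟩
    rw [toPoly_append, h2, h4, List.filter_cons]
    by_cases h : (toExp n t.2).degree ≤ d
    · simp [h, Choice.subst]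
    · simp [h]

end

/-! ### Gröbner bases -/

section Groebner

variable {F : Type u} [Field F] {n : ℕ}

/-- Leading coefficients are units, so both initial ideals are generated by monomials, and a
monomial lies in such an ideal exactly when a generator divides it. -/
theorem isGroebner_iff {J : Ideal (MvPolynomial (Fin n) F)} {B : Set (MvPolynomial (Fin n) F)} :
    IsGroebner J B ↔ B.Finite ∧ B ⊆ J ∧ ∀ f ∈ J, f ≠ 0 → ∃ b ∈ B, b ≠ 0 ∧
      (MonomialOrder.degLex (σ := Fin n)).degree b ≤ MonomialOrder.degLex.degree f := by
  refine and_congr_right fun _ => and_congr_right fun hBJ => ?_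
  rw [MonomialOrder.span_leadingTerm_eq_span_monomial',
    MonomialOrder.span_leadingTerm_eq_span_monomial']
  constructor
  · classical
    intro h f hf hf0
    have h1 : monomial ((MonomialOrder.degLex (σ := Fin n)).degree f) (1 : F) ∈
        Ideal.span ((fun p => monomial (MonomialOrder.degLex.degree p) (1 : F)) '' (B \ {0})) := by
      rw [h]
      exact Ideal.subset_span ⟨f, ⟨hf, hf0⟩, rfl⟩
    rw [← Set.image_image (fun s => monomial s (1 : F)) MonomialOrder.degLex.degree,
      mem_ideal_span_monomial_image] at h1
    obtain ⟨_, ⟨b, hb, rfl⟩, hle⟩ := h1 _ (by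
      rw [support_monomial, if_neg one_ne_zero, Finset.mem_singleton])
    exact ⟨b, hb.1, hb.2, hle⟩
  · intro h
    refine le_antisymm (Ideal.span_mono (Set.image_mono (Set.sdiff_subset_sdiff_left hBJ)))
      (Ideal.span_le.2 ?_)
    rintro _ ⟨f, ⟨hf, hf0⟩, rfl⟩
    obtain ⟨b, hb, hb0, hle⟩ := h f hf hf0
    obtain ⟨s, hs⟩ := exists_add_of_le hle
    have : monomial ((MonomialOrder.degLex (σ := Fin n)).degree f) (1 : F) =
        monomial s 1 * monomial (MonomialOrder.degLex.degree b) 1 := by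
      rw [monomial_mul, hs, add_comm, one_mul]
    simp only
    rw [this]
    exact Ideal.mul_mem_left _ _ (Ideal.subset_span ⟨b, ⟨hb, hb0⟩, rfl⟩)

/-- Divide `f` by the nonzero members of `B` of degree at most `k`. In a graded order no summand
exceeds the degree of `f`. A nonzero remainder would lie in `J` with degree at most `k`, and a
member of `B` whose leading monomial divides that of the remainder would itself have degree at most
`k`, contradicting the division. -/
theorem IsGroebner.mem_span {J : Ideal (MvPolynomial (Fin n) F)}
    {B : Set (MvPolynomial (Fin n) F)} (hB : IsGroebner J B) {k : ℕ} {f : MvPolynomial (Fin n) F}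
    (hf : f ∈ J) (hk : f.totalDegree ≤ k) :
    f ∈ Submodule.span F {q | ∃ s : Fin n →₀ ℕ, s.degree ≤ k ∧
      ∃ b ∈ B, b.totalDegree ≤ k ∧ q = monomial s (1 : F) * b} := by
  obtain ⟨-, hBJ, hB⟩ := isGroebner_iff.1 hB
  obtain ⟨g, r, hfr, hdeg, hr⟩ := MonomialOrder.div_set (m := MonomialOrder.degLex)
    (B := {b | b ∈ B ∧ b ≠ 0 ∧ b.totalDegree ≤ k})
    (fun b hb => by simpa [isUnit_iff_ne_zero] using hb.2.1) f
  have hsum : Finsupp.linearCombination _ (fun b : {b | b ∈ B ∧ b ≠ 0 ∧ b.totalDegree ≤ k} =>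
      (b : MvPolynomial (Fin n) F)) g = ∑ b ∈ g.support, g b * (b : MvPolynomial (Fin n) F) := by
    rw [Finsupp.linearCombination_apply]
    rfl
  rw [hsum] at hfr
  have hterm : ∀ b, (g b * (b : MvPolynomial (Fin n) F)).totalDegree ≤ k := fun b => by
    rw [mul_comm]
    exact (degLex_totalDegree_monotone (hdeg b)).trans hk
  have hr0 : r = 0 := by
    by_contra h
    have hrJ : r ∈ J := by
      rw [eq_sub_of_add_eq' hfr.symm]
      exact J.sub_mem hf (J.sum_mem fun b _ => J.mul_mem_left _ (hBJ b.2.1))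
    have hrk : r.totalDegree ≤ k := by
      rw [eq_sub_of_add_eq' hfr.symm]
      exact (totalDegree_sub _ _).trans (max_le hk (totalDegree_finsetSum_le fun b _ => hterm b))
    obtain ⟨b, hb, hb0, hle⟩ := hB r hrJ h
    refine hr _ (MonomialOrder.degree_mem_support h) b ⟨hb, hb0, ?_⟩ hle
    rw [← degree_degLexDegree]
    refine le_trans ?_ hrk
    rw [← degree_degLexDegree]
    exact Finsupp.degree_mono hle
  rw [hfr, hr0, add_zero]
  refine Submodule.sum_mem _ fun b hb => ?_
  -- Degrees add in a domain, so the bound on the product bounds the quotient.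
  have hgk : (g b).totalDegree ≤ k := by
    have := hterm b
    rw [totalDegree_mul_of_isDomain (Finsupp.mem_support_iff.1 hb) b.2.2.1] at this
    omega
  have hb' : g b * (b : MvPolynomial (Fin n) F) =
      ∑ s ∈ (g b).support, monomial s ((g b).coeff s) * (b : MvPolynomial (Fin n) F) := by
    rw [← Finset.sum_mul, ← as_sum (g b)]
  rw [hb']
  refine Submodule.sum_mem _ fun s hs => ?_
  have : monomial s ((g b).coeff s) * (b : MvPolynomial (Fin n) F) =
      (g b).coeff s • (monomial s (1 : F) * (b : MvPolynomial (Fin n) F)) := by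
    rw [← smul_mul_assoc, smul_monomial, smul_eq_mul, mul_one]
  rw [this]
  exact Submodule.smul_mem _ _ (Submodule.subset_span
    ⟨s, (le_totalDegree hs).trans hgk, b, b.2.1, b.2.2.2, rfl⟩)

/-- The initial ideal is finitely generated, and generators can be chosen among the leading terms
themselves. -/
theorem exists_isGroebner (J : Ideal (MvPolynomial (Fin n) F)) : ∃ B, IsGroebner J B := by
  classical
  have hfg : (Ideal.span ((MonomialOrder.degLex (σ := Fin n)).leadingTerm ''
      (J : Set (MvPolynomial (Fin n) F)))).FG :=
    IsNoetherian.noetherian _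
  obtain ⟨t, ht, h⟩ := (Submodule.fg_span_iff_fg_span_finset_subset _).1 hfg
  obtain ⟨B, hB, rfl⟩ := Finset.subset_set_image_iff.1 ht
  exact ⟨B, B.finite_toSet, hB, by rw [← Finset.coe_image]; exact h.symm⟩

/-- In an arbitrary Gröbner basis the members of degree at most `d` are exchanged for `G`. Each
nonzero one removed has a counterpart in `G` with the same leading monomial, so all divisibilities
survive. -/
theorem isTruncGroebner_of_forall {d : ℕ} {J : Ideal (MvPolynomial (Fin n) F)}
    {G : Set (MvPolynomial (Fin n) F)} (hfin : G.Finite) (hJ : G ⊆ J)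
    (hd : ∀ g ∈ G, g.totalDegree ≤ d)
    (h : ∀ f ∈ J, f ≠ 0 → f.totalDegree ≤ d → ∃ g ∈ G, g ≠ 0 ∧
      (MonomialOrder.degLex (σ := Fin n)).degree g = MonomialOrder.degLex.degree f) :
    IsTruncGroebner d J G := by
  obtain ⟨B, hB⟩ := exists_isGroebner J
  obtain ⟨hBfin, hBJ, hB⟩ := isGroebner_iff.1 hB
  refine ⟨G ∪ {b | b ∈ B ∧ d < b.totalDegree}, isGroebner_iff.2
    ⟨hfin.union (hBfin.subset fun b hb => hb.1), Set.union_subset hJ fun b hb => hBJ hb.1,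
      fun f hf hf0 => ?_⟩, ?_⟩
  · by_cases hfd : f.totalDegree ≤ d
    · obtain ⟨g, hg, hg0, hle⟩ := h f hf hf0 hfd
      exact ⟨g, Or.inl hg, hg0, hle.le⟩
    · obtain ⟨b, hb, hb0, hle⟩ := hB f hf hf0
      by_cases hbd : b.totalDegree ≤ d
      · obtain ⟨g, hg, hg0, hle'⟩ := h b (hBJ hb) hb0 hbd
        exact ⟨g, Or.inl hg, hg0, hle'.le.trans hle⟩
      · exact ⟨b, Or.inr ⟨hb, not_le.1 hbd⟩, hb0, hle⟩
  · ext g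
    simp only [Set.mem_ofPred_eq, Set.mem_union]
    constructor
    · exact fun hg => ⟨Or.inl hg, hd g hg⟩
    · rintro ⟨hg | hg, hgd⟩
      · exact hg
      · exact absurd hg.2 (not_lt.2 hgd)

end Groebner

/-! ### The ideal of an instance -/

section Ideals

variable {F : Type u} [Field F] {D E : Finset F}

/-- The value of a polynomial at an assignment. -/
noncomputable def evalAt {n : ℕ} (φ : Fin n → D) : MvPolynomial (Fin n) F →+* F :=
  eval fun x => ((φ x : D) : F)

theorem CSP.mem_domain_ideal_of_forall {n : ℕ} {f : MvPolynomial (Fin n) F}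
    (h : ∀ φ : Fin n → D, evalAt φ f = 0) :
    f ∈ Ideal.span (Set.range fun i : Fin n => ∏ a ∈ D, (X i - C a)) := by
  -- The Nullstellensatz needs nonempty grids. For empty `D`, either there are no variables and the
  -- constant `f` is tested at the empty assignment, or the empty product `1` is among the
  -- generators.
  rcases D.eq_empty_or_nonempty with rfl | hD
  · rcases n with _ | n
    · have h0 := h fun x => x.elim0
      rw [eq_C_of_isEmpty f, evalAt, eval_C] at h0
      rw [eq_C_of_isEmpty f, h0, C_0]
      exact Ideal.zero_mem _
    · have : (1 : MvPolynomial (Fin (n + 1)) F) ∈ Ideal.span (Set.range fun i : Fin (n + 1) =>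
          ∏ a ∈ (∅ : Finset F), (X i - C a)) := Ideal.subset_span ⟨0, by simp⟩
      rw [(Ideal.eq_top_iff_one _).2 this]
      trivial
  · obtain ⟨c, -, hc⟩ := combinatorial_nullstellensatz_exists_linearCombination (fun _ => D)
      (fun _ => hD) f fun x hx => h fun i => ⟨x i, hx i⟩
    rw [hc, Finsupp.linearCombination_apply]
    exact Ideal.sum_mem _ fun i _ => Ideal.mul_mem_left _ _ (Ideal.subset_span ⟨i, rfl⟩)

open Classical in
/-- A polynomial that vanishes at all assignments other than `φ`. -/
noncomputable def indicator {n : ℕ} (φ : Fin n → D) : MvPolynomial (Fin n) F :=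
  ∏ i, ∏ a ∈ D.erase (φ i), C ((φ i : F) - a)⁻¹ * (X i - C a)

open Classical in
theorem evalAt_indicator {n : ℕ} (φ ψ : Fin n → D) :
    evalAt ψ (indicator φ) = if ψ = φ then 1 else 0 := by
  classical
  simp only [evalAt, indicator, map_prod, map_mul, map_sub, eval_C, eval_X]
  split
  · next h =>
    subst h
    refine Finset.prod_eq_one fun i _ => Finset.prod_eq_one fun a ha => ?_
    exact inv_mul_cancel₀ (sub_ne_zero.2 (Finset.ne_of_mem_erase ha).symm)
  · next h =>
    obtain ⟨i, hi⟩ := Function.ne_iff.1 h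
    refine Finset.prod_eq_zero (Finset.mem_univ i) (Finset.prod_eq_zero (i := (ψ i : F)) ?_ ?_)
    · exact Finset.mem_erase.2 ⟨fun h' => hi (Subtype.ext h'), (ψ i).2⟩
    · simp

/-- Every tuple `v` of the relation differs from `φ` at some position of the scope, and there the
indicator has the factor `x_{s_j} - v_j`. So it lies in each ideal of the intersection. -/
theorem indicator_mem {n : ℕ} {φ : Fin n → D} {c : Constraint D n}
    (h : (fun j => φ (c.scope j)) ∉ c.rel) : indicator φ ∈ c.ideal := by
  classical
  simp only [Constraint.ideal, Submodule.mem_iInf]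
  intro v hv
  have : ∃ j, φ (c.scope j) ≠ v j := by
    by_contra! h'
    exact h (by rwa [show (fun j => φ (c.scope j)) = v from funext h'])
  obtain ⟨j, hj⟩ := this
  have h1 : (X (c.scope j) - C ((v j : D) : F) : MvPolynomial (Fin n) F) ∣
      ∏ a ∈ D.erase (φ (c.scope j)), C ((φ (c.scope j) : F) - a)⁻¹ * (X (c.scope j) - C a) :=
    (Dvd.intro_left _ rfl).trans (Finset.dvd_prod_of_mem (a := ((v j : D) : F)) _
      (Finset.mem_erase.2 ⟨fun h' => hj (Subtype.ext h'.symm), (v j).2⟩))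
  exact Ideal.mem_of_dvd _ (h1.trans (Finset.dvd_prod_of_mem (fun i =>
    ∏ a ∈ D.erase (φ i : F), C ((φ i : F) - a)⁻¹ * (X i - C a)) (Finset.mem_univ (c.scope j))))
    (Ideal.subset_span ⟨j, rfl⟩)

/-- For the nontrivial direction, `f` is compared with its interpolant `∑ f(φ) · indicator φ`. The
difference vanishes on `D^n`; in the sum, solutions contribute zero and non-solutions contribute
members of constraint ideals. -/
theorem CSP.mem_ideal_iff (P : CSP D) (f : MvPolynomial (Fin P.numVars) F) :
    f ∈ P.ideal ↔ ∀ φ, P.IsSolution φ → evalAt φ f = 0 := by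
  classical
  constructor
  · intro hf φ hφ
    have : P.ideal ≤ RingHom.ker (evalAt φ) := by
      refine sup_le (iSup₂_le fun c hc => ?_) (Ideal.span_le.2 ?_)
      · refine (iInf₂_le _ (hφ c hc)).trans (Ideal.span_le.2 ?_)
        rintro _ ⟨j, rfl⟩
        simp [evalAt]
      · rintro _ ⟨i, rfl⟩
        simp only [SetLike.mem_coe, RingHom.mem_ker, evalAt, map_prod, map_sub, eval_X, eval_C]
        exact Finset.prod_eq_zero (φ i).2 (sub_self _)
    exact this hf
  · intro h
    have h1 : f - ∑ φ : Fin P.numVars → D, C (evalAt φ f) * indicator φ ∈ P.ideal := by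
      refine le_sup_right (a := ⨆ c ∈ P.constraints, c.ideal)
        (CSP.mem_domain_ideal_of_forall fun ψ => ?_)
      rw [map_sub, map_sum]
      simp only [map_mul, evalAt_indicator]
      simp [evalAt]
    have h2 : ∑ φ : Fin P.numVars → D, C (evalAt φ f) * indicator φ ∈ P.ideal := by
      refine Ideal.sum_mem _ fun φ _ => ?_
      by_cases hφ : P.IsSolution φ
      · rw [h φ hφ, C_0, zero_mul]
        exact Ideal.zero_mem _
      · unfold CSP.IsSolution at hφ
        push Not at hφ
        obtain ⟨c, hc, hφ⟩ := hφ
        have hle : c.ideal ≤ P.ideal := le_sup_of_le_left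
          (le_iSup₂ (f := fun (c : Constraint D P.numVars) (_ : c ∈ P.constraints) => c.ideal)
            c hc)
        exact Ideal.mul_mem_left _ _ (hle (indicator_mem hφ))
    simpa using Ideal.add_mem _ h1 h2

variable {S : SubstCollection D E}

theorem Choice.evalAt_subst {n m : ℕ} (s : Choice S n m) (ψ : Fin m → E)
    (g : MvPolynomial (Fin n) F) :
    evalAt ψ (s.subst g) = evalAt (fun x => S.map (s.idx x) fun j => ψ (s.vars x j)) g := by
  have h : ∀ x, eval (fun y => ((ψ y : E) : F)) (rename (s.vars x) (S.poly (s.idx x))) =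
      ((S.map (s.idx x) fun j => ψ (s.vars x j) : D) : F) := by
    intro x
    rw [eval_rename, ← S.eval_poly]
    rfl
  exact (eval₂Hom_bind₁ (RingHom.id F) _ _ g).trans (congrArg (fun v => eval v g) (funext h))

theorem Choice.mem_constraint_rel_iff {n m : ℕ} (s : Choice S n m) (c : Constraint D n)
    (ψ : Fin m → E) : (fun j => ψ ((s.constraint c).scope j)) ∈ (s.constraint c).rel ↔
      (fun j => S.map (s.idx (c.scope j)) fun q => ψ (s.vars (c.scope j) q)) ∈ c.rel := by
  have h : ∀ p p' : (Σ j : Fin c.arity, Fin (S.arity (s.idx (c.scope j)))), p = p' →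
      ψ (s.vars (c.scope p.1) p.2) = ψ (s.vars (c.scope p'.1) p'.2) := by
    rintro p _ rfl
    rfl
  have : (fun j => S.map (s.idx (c.scope j)) fun q => ψ (s.vars (c.scope j) q)) =
      fun j => S.map (s.idx (c.scope j)) fun q =>
        ψ ((s.constraint c).scope (finSigmaFinEquiv ⟨j, q⟩)) := by
    ext1 j
    congr 1
    ext1 q
    exact h ⟨j, q⟩ _ (Equiv.symm_apply_apply _ _).symm
  rw [this]
  rfl

theorem Choice.Valid.isSolution_map {P : CSP D} {P' : CSP E}
    {s : Choice S P.numVars P'.numVars} (hs : s.Valid P P') {ψ : Fin P'.numVars → E}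
    (hψ : P'.IsSolution ψ) : P.IsSolution fun x => S.map (s.idx x) fun j => ψ (s.vars x j) := by
  intro c hc
  exact (s.mem_constraint_rel_iff c ψ).1 (hψ _ ((hs.constraints _).2 ⟨c, hc, rfl⟩))

/-- The assignments supplied by `common` are glued: a variable of `P'` takes its value from the
assignment belonging to a block that contains it. Distinct blocks are disjoint, so the glued map
restricts to the right assignment on each `Y_x`. -/
theorem Choice.Valid.exists_lift {P : CSP D} {P' : CSP E}
    {s : Choice S P.numVars P'.numVars} (hs : s.Valid P P') {φ : Fin P.numVars → D}
    (hφ : P.IsSolution φ) : ∃ ψ : Fin P'.numVars → E, P'.IsSolution ψ ∧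
      (fun x => S.map (s.idx x) fun j => ψ (s.vars x j)) = φ := by
  -- The assignment is chosen for the set `Z` and not for `x`, so that variables with the same block
  -- share it.
  have key : ∀ Z : Set (Fin P'.numVars), (∃ x, Set.range (s.vars x) = Z) →
      ∃ a : Fin P'.numVars → E, ∀ x, Set.range (s.vars x) = Z →
        (S.map (s.idx x) fun j => a (s.vars x j)) = φ x := by
    rintro _ ⟨x₀, rfl⟩
    obtain ⟨a, ha⟩ := hs.common φ hφ x₀
    refine ⟨a, fun x hx => Subtype.ext ?_⟩
    rw [ha x hx, ← S.eval_poly]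
  choose a ha using key
  choose x₀ hx₀ using hs.cover
  have hcongr : ∀ Z Z' h h', Z = Z' → a Z h = a Z' h' := by
    rintro Z _ h h' rfl
    rfl
  have h : (fun x => S.map (s.idx x) fun j =>
      a (Set.range (s.vars (x₀ (s.vars x j)))) ⟨_, rfl⟩ (s.vars x j)) = φ := by
    ext1 x
    rw [← ha _ ⟨x, rfl⟩ x rfl]
    congr 1
    ext1 j
    rcases hs.eq_or_disjoint (x₀ (s.vars x j)) x with h | h
    · rw [hcongr _ _ _ ⟨x, rfl⟩ h]
    · exact absurd ⟨j, rfl⟩ (Set.disjoint_left.1 h (hx₀ (s.vars x j)))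
  refine ⟨fun y => a (Set.range (s.vars (x₀ y))) ⟨_, rfl⟩ y, fun c' hc' => ?_, h⟩
  obtain ⟨c, hc, rfl⟩ := (hs.constraints c').1 hc'
  have := hφ c hc
  rw [← h] at this
  exact (s.mem_constraint_rel_iff c
    fun y => a (Set.range (s.vars (x₀ y))) ⟨_, rfl⟩ y).2 this

/-- Both sides are vanishing conditions, and the solutions of `P` are exactly the images of those of
`P'`. -/
theorem Choice.Valid.subst_mem_ideal_iff {P : CSP D} {P' : CSP E}
    {s : Choice S P.numVars P'.numVars} (hs : s.Valid P P')
    (g : MvPolynomial (Fin P.numVars) F) : s.subst g ∈ P'.ideal ↔ g ∈ P.ideal := by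
  rw [CSP.mem_ideal_iff, CSP.mem_ideal_iff]
  constructor
  · intro h φ hφ
    obtain ⟨ψ, hψ, rfl⟩ := hs.exists_lift hφ
    rw [← s.evalAt_subst]
    exact h ψ hψ
  · intro h ψ hψ
    rw [s.evalAt_subst]
    exact h _ (hs.isSolution_map hψ)

end Ideals

/-! ### The outputs of the algorithms -/

section Outputs

variable {F : Type u} [Field F] {n : ℕ}

/-- The polynomials given by a list of lists of terms, as a set. -/
abbrev polySet (n : ℕ) (ws : List (TermList F)) : Set (MvPolynomial (Fin n) F) :=
  {f | f ∈ ws.map (toPoly n)}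

theorem hasArity_of_mem_multiples {F : Type u} {k : ℕ} {G : List (TermList F)} (hG : ∀ g ∈ G, g.HasArity n) :
    ∀ w ∈ multiples k n G, w.HasArity n := by
  intro w hw
  obtain ⟨e, he, hw⟩ := List.mem_flatMap.1 hw
  obtain ⟨g, hg, rfl⟩ := List.mem_map.1 hw
  exact (hG g hg).shift (length_of_mem_monomials he)

/-- A full and a truncated basis are alike here: `G` lies in `J` and contains all members of degree
at most `k` of some Gröbner basis. Products of degree larger than `k` do no harm, being in `J` as
well. -/
theorem mem_span_multiples_iff {k : ℕ} {G : List (TermList F)} (hG : ∀ g ∈ G, g.HasArity n)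
    {J : Ideal (MvPolynomial (Fin n) F)}
    (hJ : IsGroebner J (polySet n G) ∨ IsTruncGroebner k J (polySet n G))
    {f : MvPolynomial (Fin n) F} (hf : f.totalDegree ≤ k) :
    f ∈ Submodule.span F (polySet n (multiples k n G)) ↔ f ∈ J := by
  have hB : ∃ B, IsGroebner J B ∧ polySet n G ⊆ J ∧ ∀ b ∈ B, b.totalDegree ≤ k →
      b ∈ polySet n G := by
    rcases hJ with hJ | ⟨B, hB, h⟩
    · exact ⟨_, hJ, hJ.2.1, fun b hb _ => hb⟩
    · exact ⟨B, hB, h ▸ fun b hb => hB.2.1 hb.1, fun b hb hbk => h ▸ ⟨hb, hbk⟩⟩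
  obtain ⟨B, hB, hGJ, hBG⟩ := hB
  constructor
  · intro h
    have hle : Submodule.span F (polySet n (multiples k n G)) ≤ J.restrictScalars F := by
      refine Submodule.span_le.2 fun q hq => ?_
      obtain ⟨w, hw, rfl⟩ := List.mem_map.1 hq
      obtain ⟨e, he, hw⟩ := List.mem_flatMap.1 hw
      obtain ⟨g, hg, rfl⟩ := List.mem_map.1 hw
      rw [toPoly_shift (hG g hg) (length_of_mem_monomials he)]
      exact J.mul_mem_left _ (hGJ (List.mem_map_of_mem hg))
    exact hle h
  · intro h
    refine Submodule.span_mono ?_ (hB.mem_span h hf)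
    rintro _ ⟨s, hs, b, hb, hbk, rfl⟩
    obtain ⟨g, hg, rfl⟩ := List.mem_map.1 (hBG b hb hbk)
    obtain ⟨e, he, rfl⟩ := exists_mem_monomials s hs
    rw [← toPoly_shift (hG g hg) (length_of_mem_monomials he)]
    exact List.mem_map_of_mem (List.mem_flatMap.2 ⟨e, he, List.mem_map_of_mem hg⟩)

theorem findRelation_spec {gs ws : List (TermList F)} (hg : ∀ p ∈ gs, p.HasArity n)
    (hw : ∀ p ∈ ws, p.HasArity n) :
    (findRelation gs ws = [] ∧ ∀ c : List F, c.length = gs.length →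
      lincomb c (gs.map (toPoly n)) ∈ Submodule.span F (polySet n ws) → ∀ a ∈ c, a = 0) ∨
    ((findRelation gs ws).length = gs.length ∧ (∃ a ∈ findRelation gs ws, a ≠ 0) ∧
      lincomb (findRelation gs ws) (gs.map (toPoly n)) ∈ Submodule.span F (polySet n ws)) := by
  classical
  unfold findRelation listCases
  split
  · next h =>
    refine Or.inl ⟨rfl, fun c hc hmem a ha => ?_⟩
    by_contra ha0
    obtain ⟨i, hi, rfl⟩ := List.mem_iff_getElem.1 ha
    obtain ⟨r, hr, hr0⟩ := relationsMod_complete hg hw hc hmem i (by simpa [hi] using ha0)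
    have := List.filter_eq_nil_iff.1 h r hr
    simp only [Bool.not_eq_true', Bool.not_eq_false, List.all_eq_true, decide_eq_true_eq] at this
    by_cases hi' : i < r.length
    · exact hr0 (by simpa [hi'] using this _ (List.getElem_mem hi'))
    · exact hr0 (by simp [not_lt.1 hi'])
  · next c t h =>
    have h' : c ∈ (relationsMod gs ws).filter fun c => !c.all fun a => decide (a = 0) :=
      h ▸ List.mem_cons_self
    rw [List.mem_filter] at h'
    obtain ⟨hc, hc0⟩ := h'
    obtain ⟨h1, h2⟩ := relationsMod_sound hg hw hc
    refine Or.inr ⟨h1, ?_, h2⟩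
    simpa using hc0

theorem answers_findRelation {D : Finset F} {I : Inst D} {m : ℕ} {gs ws : List (TermList F)}
    (hg : ∀ p ∈ gs, p.HasArity m) (hw : ∀ p ∈ ws, p.HasArity m)
    (hlen : gs.length = I.polys.length)
    (h : ∀ c : List F, lincomb c (gs.map (toPoly m)) ∈ Submodule.span F (polySet m ws) ↔
      lincomb c I.polys ∈ I.csp.ideal) : Answers I (enc F (findRelation gs ws)) := by
  have key : ∀ c : List F, c.length = I.polys.length →
      lincomb c I.polys = ∑ i, toVec I.polys.length c i • I.polys.get i := by
    intro c hc
    rw [lincomb_eq_sum hc]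
    simp
  rcases findRelation_spec hg hw with ⟨h1, h2⟩ | ⟨h1, ⟨a, ha, ha0⟩, h3⟩
  · refine Or.inl ⟨by rw [h1]; rfl, ?_⟩
    rintro ⟨c, hc0, hc⟩
    have hc' : toVec I.polys.length (List.ofFn c) = c := by
      ext i
      simp [toVec]
    refine hc0 (funext fun i => h2 (List.ofFn c) (by simp [hlen]) ((h _).2 ?_) _ ?_)
    · rwa [key _ (by simp), hc']
    · exact (List.mem_ofFn' _ _).2 ⟨i, rfl⟩
  · rw [hlen] at h1
    refine Or.inr ⟨toVec I.polys.length (findRelation gs ws), ⟨?_, ?_⟩, ?_⟩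
    · intro h0
      obtain ⟨i, hi, rfl⟩ := List.mem_iff_getElem.1 ha
      have := congrFun h0 ⟨i, h1 ▸ hi⟩
      exact ha0 (by simpa [toVec, hi] using this)
    · rw [← key _ h1]
      exact (h _).1 h3
    · rw [enc_list]
      congr 1
      refine List.ext_getElem (by simp [h1]) fun i hi _ => ?_
      rw [List.length_map] at hi
      simp [toVec, hi, enc_field]

theorem degree_monomial_add {s : Fin n →₀ ℕ} {a : F} (ha : a ≠ 0) {q : MvPolynomial (Fin n) F}
    (hq : q ∈ restrictSupport F {t | toDegLex t < toDegLex s}) :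
    monomial s a + q ≠ 0 ∧ (MonomialOrder.degLex (σ := Fin n)).degree (monomial s a + q) = s := by
  have hs : s ∈ (monomial s a + q).support := by
    have : q.coeff s = 0 := by
      by_contra h
      exact lt_irrefl (toDegLex s) ((mem_restrictSupport_iff F).1 hq (mem_support_iff.2 h))
    simp [this, ha]
  refine ⟨fun h => by simp [h] at hs, MonomialOrder.degLex.toSyn.injective (le_antisymm ?_
    (MonomialOrder.le_degree hs))⟩
  rw [MonomialOrder.degree_le_iff]
  intro t ht
  rcases Finset.mem_union.1 (support_add ht) with h | h
  · rw [Finset.mem_singleton.1 (support_monomial_subset h)]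
  · exact le_of_lt ((mem_restrictSupport_iff F).1 hq h)

/-- The exponent vector `e`, followed by the smaller ones in `es`. -/
def downTo (es : List (List ℕ)) (e : List ℕ) : List (List ℕ) :=
  e :: es.filter fun f => degLexLt f e

theorem withLeading_map (es : List (List ℕ)) (σ : List ℕ → TermList F) (ws : List (TermList F))
    (e : List ℕ) : withLeading (es.map fun f => (f, σ f)) ws (e, σ e) =
      ((relationsMod ((downTo es e).map σ) ws).filter fun c =>
        listCases c false fun a _ => !@decide (a = 0) (Classical.propDecidable _)).map
          fun c => c.zip (downTo es e) := by
  simp [withLeading, downTo, List.filter_map, Function.comp_def]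

/-- By `h`, relations modulo `ws` between the images of monomials are the elements of `J` of degree
at most `d`. A relation between `e` and strictly smaller monomials, nonzero at `e`, is an element
with leading monomial `e`, and one is found whenever it exists. Repetitions in the list of monomials
are harmless, since the strict comparison keeps further copies of `e` out of the tail. -/
theorem isTruncGroebner_withLeading {d m : ℕ} {J : Ideal (MvPolynomial (Fin n) F)}
    {σ : List ℕ → TermList F} {ws : List (TermList F)}
    (hσ : ∀ e ∈ monomials n d, (σ e).HasArity m) (hw : ∀ w ∈ ws, w.HasArity m)
    (h : ∀ es ⊆ monomials n d, ∀ c : List F,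
      lincomb c ((es.map σ).map (toPoly m)) ∈ Submodule.span F (polySet m ws) ↔
        lincomb c (es.map fun e => monomial (toExp n e) (1 : F)) ∈ J)
    {G : List (TermList F)} (hG : G = (monomials n d).flatMap fun e =>
      withLeading ((monomials n d).map fun f => (f, σ f)) ws (e, σ e)) :
    (∀ g ∈ G, g.HasArity n) ∧ IsTruncGroebner d J (polySet n G) := by
  classical
  have hsub : ∀ e ∈ monomials n d, downTo (monomials n d) e ⊆ monomials n d := by
    intro e he f hf
    rcases List.mem_cons.1 hf with rfl | hf
    · exact he
    · exact List.mem_of_mem_filter hf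
  have hmem : ∀ g, g ∈ G ↔ ∃ e ∈ monomials n d, ∃ a c,
      a :: c ∈ relationsMod ((downTo (monomials n d) e).map σ) ws ∧ a ≠ 0 ∧
        g = (a :: c).zip (downTo (monomials n d) e) := by
    intro g
    rw [hG]
    simp only [withLeading_map, List.mem_flatMap, List.mem_map, List.mem_filter]
    refine exists_congr fun e => and_congr_right fun _ => ?_
    constructor
    · rintro ⟨_ | ⟨a, c⟩, ⟨h1, h2⟩, rfl⟩
      · simp [listCases] at h2
      · exact ⟨a, c, h1, by simpa [listCases] using h2, rfl⟩
    · rintro ⟨a, c, h1, h2, rfl⟩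
      exact ⟨a :: c, ⟨h1, by simpa [listCases] using h2⟩, rfl⟩
  have hσ' : ∀ e ∈ monomials n d, ∀ p ∈ (downTo (monomials n d) e).map σ, p.HasArity m := by
    intro e he p hp
    obtain ⟨f, hf, rfl⟩ := List.mem_map.1 hp
    exact hσ f (hsub e he hf)
  have hlow : ∀ e ∈ monomials n d, ∀ c : List F,
      lincomb c (((monomials n d).filter fun f => degLexLt f e).map
        fun e => monomial (toExp n e) (1 : F)) ∈
        restrictSupport F {t | toDegLex t < toDegLex (toExp n e)} := by
    intro e he c
    refine lincomb_mem c fun v hv => ?_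
    obtain ⟨f, hf, rfl⟩ := List.mem_map.1 hv
    rw [List.mem_filter] at hf
    refine (monomial_mem_restrictSupport F).2 (Or.inl ?_)
    exact (degLexLt_iff (length_of_mem_monomials hf.1) (length_of_mem_monomials he)).1 hf.2
  refine ⟨?_, isTruncGroebner_of_forall (List.finite_toSet _) ?_ ?_ ?_⟩
  · intro g hg t ht
    obtain ⟨e, he, a, c, -, -, rfl⟩ := (hmem g).1 hg
    exact length_of_mem_monomials (hsub e he (List.of_mem_zip ht).2)
  · intro q hq
    obtain ⟨g, hg, rfl⟩ := List.mem_map.1 hq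
    obtain ⟨e, he, a, c, hr, -, rfl⟩ := (hmem g).1 hg
    rw [toPoly_zip]
    exact (h _ (hsub e he) _).1 (relationsMod_sound (hσ' e he) hw hr).2
  · intro q hq
    obtain ⟨g, hg, rfl⟩ := List.mem_map.1 hq
    obtain ⟨e, he, a, c, hr, -, rfl⟩ := (hmem g).1 hg
    rw [toPoly_zip, ← mem_restrictTotalDegree]
    refine lincomb_mem _ fun v hv => ?_
    obtain ⟨f, hf, rfl⟩ := List.mem_map.1 hv
    rw [mem_restrictTotalDegree]
    exact (totalDegree_monomial_le _ _).trans (degree_le_of_mem_monomials (hsub e he hf))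
  · intro f hf hf0 hfd
    have hdeg : (MonomialOrder.degLex (σ := Fin n)).degree f ∈ f.support :=
      MonomialOrder.degree_mem_support hf0
    obtain ⟨e, he, hes⟩ := exists_mem_monomials (k := d) _ ((le_totalDegree hdeg).trans hfd)
    -- Without its leading term, `f` involves only smaller monomials of degree at most `d`, all of
    -- them listed.
    have hrest : f - monomial (toExp n e) (f.coeff (toExp n e)) ∈ Submodule.span F
        {q | q ∈ ((monomials n d).filter fun f => degLexLt f e).map
          fun e => monomial (toExp n e) (1 : F)} := by
      have h1 : f - monomial (toExp n e) (f.coeff (toExp n e)) ∈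
          restrictSupport F {t | t ∈ f.support ∧ t ≠ toExp n e} := by
        rw [mem_restrictSupport_iff]
        intro t ht
        rw [Finset.mem_coe] at ht
        have h3 : t ≠ toExp n e := by
          rintro rfl
          simp at ht
        refine ⟨?_, h3⟩
        rw [mem_support_iff, coeff_sub, coeff_monomial, if_neg h3.symm, sub_zero] at ht
        exact mem_support_iff.2 ht
      rw [restrictSupport_eq_span] at h1
      refine Submodule.span_mono ?_ h1
      rintro _ ⟨t, ⟨ht, hte⟩, rfl⟩
      obtain ⟨e', he', rfl⟩ := exists_mem_monomials (k := d) t ((le_totalDegree ht).trans hfd)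
      refine List.mem_map.2 ⟨e', List.mem_filter.2 ⟨he', ?_⟩, rfl⟩
      rw [degLexLt_iff (length_of_mem_monomials he') (length_of_mem_monomials he)]
      refine lt_of_le_of_ne ?_ fun h' => hte (toDegLex_injective h')
      rw [hes]
      exact MonomialOrder.le_degree (m := MonomialOrder.degLex) ht
    obtain ⟨c, hc, hc'⟩ := exists_lincomb_of_mem_span hrest
    have ha : f.coeff (toExp n e) ≠ 0 := by
      rw [hes]
      exact mem_support_iff.1 hdeg
    have hcf : lincomb (f.coeff (toExp n e) :: c) ((downTo (monomials n d) e).map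
        fun e => monomial (toExp n e) (1 : F)) = f := by
      rw [downTo, List.map_cons, lincomb_cons, hc', smul_monomial, smul_eq_mul, mul_one]
      exact add_sub_cancel _ _
    -- The coefficients of `f` form a relation that is nonzero at position `0`, the place of the
    -- leading monomial.
    obtain ⟨r, hr, hr0⟩ := relationsMod_complete (hσ' e he) hw
      (c := f.coeff (toExp n e) :: c) (by simpa [downTo] using hc)
      ((h _ (hsub e he) _).2 (hcf.symm ▸ hf)) 0 (by simpa using ha)
    cases r with
    | nil => simp at hr0
    | cons a r =>
      refine ⟨_, List.mem_map_of_mem ((hmem _).2 ⟨e, he, a, r, hr, by simpa using hr0, rfl⟩), ?_⟩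
      have hform : toPoly n ((a :: r).zip (downTo (monomials n d) e)) =
          monomial (toExp n e) a + lincomb r (((monomials n d).filter fun f => degLexLt f e).map
            fun e => monomial (toExp n e) (1 : F)) := by
        rw [toPoly_zip, downTo, List.map_cons, lincomb_cons, smul_monomial, smul_eq_mul, mul_one]
      rw [hform, ← hes]
      exact degree_monomial_add (by simpa using hr0) (hlow e he r)

end Outputs

/-! ### The reduction -/

section Reduction

variable {F : Type u} [Field F]

/-- The codes of the members of `S`. -/
structure Coded {F : Type u} {α : Type*} (codes : Data F → α → Prop) (S : Set α) where
  obj : α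
  code : Data F
  mem : obj ∈ S
  codes_obj : codes code obj

instance {F : Type u} {α : Type*} (codes : Data F → α → Prop) (S : Set α) :
    Code F (Coded codes S) := ⟨Coded.code⟩

/-- An algorithm with a promise on its input becomes a total function on the type of admissible
codes, to which the calculus applies. An object has many codes, hence the pairs of object and code.
-/
theorem PolyTimeOn.exists_polyFn {α : Type*} {p : Prog F} {codes : Data F → α → Prop} {S : Set α}
    {post : α → Data F → Prop} (h : PolyTimeOn p codes S post) :
    ∃ out : Coded codes S → Data F, PolyFn F out ∧ ∀ i, post i.obj (out i) := by
  obtain ⟨T, hT⟩ := h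
  choose y t h1 h2 h3 using fun i : Coded codes S => hT i.obj i.mem i.code i.codes_obj
  exact ⟨y, ⟨p, T, fun i => ⟨t i, h1 i, h2 i⟩⟩, h3⟩

theorem PolyFn.exists_polyTimeOn {α : Type*} {codes : Data F → α → Prop} {S : Set α}
    {post : α → Data F → Prop} {β : Type*} [Code F β] {out : Coded codes S → β}
    (h : PolyFn F out) (hpost : ∀ i, post i.obj (enc F (out i))) :
    ∃ p : Prog F, PolyTimeOn p codes S post := by
  obtain ⟨p, T, hp⟩ := h
  refine ⟨p, T, fun a ha x hx => ?_⟩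
  obtain ⟨t, h1, h2⟩ := hp ⟨a, x, ha, hx⟩
  exact ⟨_, t, h1, h2, hpost ⟨a, x, ha, hx⟩⟩

variable {D E : Finset F} {S : SubstCollection D E}

theorem Choice.subst_lincomb {n m : ℕ} (s : Choice S n m) (c : List F)
    (gs : List (MvPolynomial (Fin n) F)) :
    s.subst (lincomb c gs) = lincomb c (gs.map s.subst) :=
  map_lincomb (bind₁ fun x => rename (s.vars x) (S.poly (s.idx x))).toLinearMap c gs

/-- From codes of instances in `X` one computes a substitution `σ` and polynomials `ws` such that
the linear relations modulo the ideal become linear relations modulo the span of `ws`. -/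
theorem exists_linearization {νX : RelNotation D} {νY : RelNotation E} {d k : ℕ}
    {X : Set (Inst D)} {Y : Set (Inst E)} (hX : X ⊆ chiIMP D d) (hY : Y ⊆ chiIMP E k)
    (hred : SubstReducible νX νY X Y S)
    (hGB : ∃ B : Prog F, PolyTimeOn B (CodesInst νY) Y fun I y =>
      ListsGroebner I y ∨ ListsTruncGroebner k I y)
    {κ : Type*} [Code F κ] (I : κ → Inst D) (hI : ∀ i, I i ∈ X) {M : κ → List (TermList F)}
    (hM : PolyFn F M) (hMI : ∀ i, ∀ p ∈ M i, p.HasArity (I i).csp.numVars)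
    (hMp : ∀ i, (M i).map (toPoly _) = (I i).polys) {c : κ → Data F} (hc : PolyFn F c)
    (hcI : ∀ i, CodesCSP νX (c i) (I i).csp) :
    ∃ (m : κ → ℕ) (σ : κ → TermList F → TermList F) (ws : κ → List (TermList F)),
      (PolyFn F fun q : κ × TermList F => σ q.1 q.2) ∧ PolyFn F ws ∧ ∀ i,
        (∀ w ∈ ws i, w.HasArity (m i)) ∧ (∀ p ∈ M i, (σ i p).HasArity (m i)) ∧
        ∀ l ⊆ M i, ∀ a : List F,
          lincomb a ((l.map (σ i)).map (toPoly (m i))) ∈ Submodule.span F (polySet (m i) (ws i)) ↔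
            lincomb a (l.map (toPoly _)) ∈ (I i).csp.ideal := by
  obtain ⟨A, hA⟩ := hred
  obtain ⟨outA, hA, hpostA⟩ := hA.exists_polyFn
  let toX : κ → Coded (CodesInst νX) X := fun i => ⟨I i, enc F (M i, c i), hI i, _, _, rfl,
    codesList_codesPoly_iff.2 ⟨M i, hMI i, hMp i, rfl⟩, hcI i⟩
  have htoX : PolyFn F toX := (hM.pair hc).of_enc_eq fun _ => rfl
  have hAX : PolyFn F fun i => outA (toX i) := hA.comp htoX
  choose P' s z hz hzP hvalid hmemY using fun i => hpostA (toX i)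
  choose y hy hyP using hzP
  -- The output tree of the reduction is reread as a triple. The constraints `y i` remain an opaque
  -- tree, merely passed on to the Gröbner basis algorithm.
  have hAX' : PolyFn F fun i => ((s i).toList, (P' i).numVars, y i) :=
    hAX.of_enc_eq fun i => by
      rw [enc_pair, enc_pair, (s i).enc_toList, enc_nat, enc_data, hz, hy]
      rfl
  have hs : PolyFn F fun i => (s i).toList := PolyFn.fst.comp hAX'
  have hm : PolyFn F fun i => (P' i).numVars := PolyFn.fst.comp (PolyFn.snd.comp hAX')
  have hzF : PolyFn F z := (PolyFn.snd.comp hAX').of_enc_eq fun i => by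
    rw [enc_pair, enc_nat, enc_data, ← hy]
    rfl
  obtain ⟨H, hH⟩ := S.exists_isTable
  have hsubst : PolyFn F fun q : κ × TermList F =>
      substTerms d H (P' q.1).numVars (s q.1).toList q.2 :=
    PolyFn.substTerms d H (hm.comp PolyFn.fst) (hs.comp PolyFn.fst) PolyFn.snd
  have hspec : ∀ i, ∀ p ∈ M i, (substTerms d H (P' i).numVars (s i).toList p).HasArity
      (P' i).numVars ∧ toPoly _ (substTerms d H (P' i).numVars (s i).toList p) =
        (s i).subst (toPoly _ p) := fun i p hp =>
    substTerms_spec hH (s i) (hMI i p hp) (hX (hI i) _ (hMp i ▸ List.mem_map_of_mem hp))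
  obtain ⟨B, hB⟩ := hGB
  obtain ⟨outB, hB, hpostB⟩ := hB.exists_polyFn
  -- The computed substituted polynomials, together with the received code of `P'`, form a
  -- legitimate code of a member of `Y`.
  let toY : κ → Coded (CodesInst νY) Y := fun i => ⟨⟨P' i, (I i).polys.map (s i).subst⟩,
    enc F ((M i).map (substTerms d H (P' i).numVars (s i).toList), z i), hmemY i, _, _, rfl,
    codesList_codesPoly_iff.2 ⟨_, fun p hp => by
      obtain ⟨q, hq, rfl⟩ := List.mem_map.1 hp
      exact (hspec i q hq).1, by
      rw [← hMp i, List.map_map, List.map_map]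
      exact List.map_congr_left fun p hp => (hspec i p hp).2, rfl⟩, y i, hy i, hyP i⟩
  have htoY : PolyFn F toY := ((hM.map hsubst).pair hzF).of_enc_eq fun _ => rfl
  have hBY : PolyFn F fun i => outB (toY i) := hB.comp htoY
  have hG : ∀ i, ∃ G : List (TermList F), (∀ g ∈ G, g.HasArity (P' i).numVars) ∧
      (IsGroebner (P' i).ideal (polySet _ G) ∨ IsTruncGroebner k (P' i).ideal (polySet _ G)) ∧
        enc F G = outB (toY i) := by
    intro i
    rcases hpostB (toY i) with ⟨G, hG, hG'⟩ | ⟨G, hG, hG'⟩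
    · obtain ⟨G, h1, rfl, h2⟩ := codesList_codesPoly_iff.1 hG
      exact ⟨G, h1, Or.inl hG', h2⟩
    · obtain ⟨G, h1, rfl, h2⟩ := codesList_codesPoly_iff.1 hG
      exact ⟨G, h1, Or.inr hG', h2⟩
  choose G hGa hGJ hGe using hG
  have hGF : PolyFn F G := hBY.of_enc_eq fun i => (hGe i).symm
  refine ⟨fun i => (P' i).numVars, fun i => substTerms d H (P' i).numVars (s i).toList,
    fun i => multiples k (P' i).numVars (G i), hsubst, PolyFn.multiples k hm hGF, fun i =>
      ⟨hasArity_of_mem_multiples (hGa i), fun p hp => (hspec i p hp).1, fun l hl a => ?_⟩⟩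
  have hmap : (l.map (substTerms d H (P' i).numVars (s i).toList)).map (toPoly _) =
      (l.map (toPoly _)).map (s i).subst := by
    rw [List.map_map, List.map_map]
    exact List.map_congr_left fun p hp => (hspec i p (hl hp)).2
  rw [hmap, mem_span_multiples_iff (hGa i) (hGJ i), ← (s i).subst_lincomb]
  · exact (hvalid i).subst_mem_ideal_iff _
  · rw [← mem_restrictTotalDegree]
    refine lincomb_mem a fun v hv => ?_
    rw [mem_restrictTotalDegree]
    obtain ⟨g, hg, rfl⟩ := List.mem_map.1 hv
    obtain ⟨p, hp, rfl⟩ := List.mem_map.1 hg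
    refine hY (hmemY i) _ (List.mem_map_of_mem ?_)
    exact hMp i ▸ List.mem_map_of_mem (hl hp)

theorem exists_decode {νX : RelNotation D} (X : Set (Inst D)) :
    ∃ (M : Coded (CodesInst νX) X → List (TermList F)) (c : Coded (CodesInst νX) X → Data F),
      PolyFn F M ∧ PolyFn F c ∧ (PolyFn F fun i : Coded (CodesInst νX) X => i.obj.csp.numVars) ∧
        ∀ i, (∀ p ∈ M i, p.HasArity i.obj.csp.numVars) ∧
          (M i).map (toPoly _) = i.obj.polys ∧ CodesCSP νX (c i) i.obj.csp := by
  choose y c hyc hy hc using fun i : Coded (CodesInst νX) X => i.codes_obj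
  choose M hM hMp hMy using fun i => codesList_codesPoly_iff.1 (hy i)
  choose w hw hwP using hc
  have h : PolyFn F fun i : Coded (CodesInst νX) X => (M i, i.obj.csp.numVars, w i) :=
    PolyFn.id.of_enc_eq fun i => by
      rw [enc_pair, hMy, enc_pair, enc_nat, enc_data, ← hw, ← hyc]
      rfl
  exact ⟨M, c, PolyFn.fst.comp h, (PolyFn.snd.comp h).of_enc_eq fun i => by
    rw [enc_pair, enc_nat, enc_data, ← hw]
    rfl, PolyFn.fst.comp (PolyFn.snd.comp h), fun i => ⟨hM i, hMp i, w i, hw i, hwP i⟩⟩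

theorem exists_solver {νX : RelNotation D} {νY : RelNotation E} {d k : ℕ}
    {X : Set (Inst D)} {Y : Set (Inst E)} (hX : X ⊆ chiIMP D d) (hY : Y ⊆ chiIMP E k)
    (hred : SubstReducible νX νY X Y S)
    (hGB : ∃ B : Prog F, PolyTimeOn B (CodesInst νY) Y fun I y =>
      ListsGroebner I y ∨ ListsTruncGroebner k I y) :
    ∃ p : Prog F, PolyTimeOn p (CodesInst νX) X Answers := by
  obtain ⟨M, c, hM, hc, -, h⟩ := exists_decode (νX := νX) X
  obtain ⟨m, σ, ws, hσ, hws, hspec⟩ := exists_linearization hX hY hred hGB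
    (fun i : Coded (CodesInst νX) X => i.obj) (fun i => i.mem) hM (fun i => (h i).1)
    (fun i => (h i).2.1) hc fun i => (h i).2.2
  refine PolyFn.exists_polyTimeOn (PolyFn.findRelation (hM.map hσ) hws) fun i => ?_
  obtain ⟨h1, h2, h3⟩ := hspec i
  refine answers_findRelation (m := m i) (fun p hp => ?_) h1 ?_ fun a => ?_
  · obtain ⟨q, hq, rfl⟩ := List.mem_map.1 hp
    exact h2 q hq
  · rw [← (h i).2.1, List.length_map, List.length_map]
  · rw [← (h i).2.1]
    exact h3 _ (List.Subset.refl _) a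

/-- The input vector is replaced by the vector of all monomials of degree at most `d`, which
`hclosed` admits. The linearization of that instance is what `withLeading` works on. -/
theorem exists_truncGroebner_program {νX : RelNotation D} {νY : RelNotation E} {d k : ℕ}
    {X : Set (Inst D)} {Y : Set (Inst E)} (hX : X ⊆ chiIMP D d) (hY : Y ⊆ chiIMP E k)
    (hred : SubstReducible νX νY X Y S)
    (hGB : ∃ B : Prog F, PolyTimeOn B (CodesInst νY) Y fun I y =>
      ListsGroebner I y ∨ ListsTruncGroebner k I y)
    (hclosed : ∀ I ∈ X, ∀ M : List (MvPolynomial (Fin I.csp.numVars) F),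
      (∀ g ∈ M, g.totalDegree ≤ d) → (⟨I.csp, M⟩ : Inst D) ∈ X) :
    ∃ p : Prog F, PolyTimeOn p (CodesInst νX) X (ListsTruncGroebner d) := by
  obtain ⟨_, c, _, hc, hn, h⟩ := exists_decode (νX := νX) X
  have hmons : PolyFn F fun i : Coded (CodesInst νX) X => monomials i.obj.csp.numVars d :=
    PolyFn.monomials hn d
  have hone : PolyFn F fun e : List ℕ => ([((1 : F), e)] : TermList F) :=
    PolyFn.cons (PolyFn.pair (PolyFn.const 1) PolyFn.id) (PolyFn.const [])
  have hM : PolyFn F fun i : Coded (CodesInst νX) X =>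
      (monomials i.obj.csp.numVars d).map fun e => ([((1 : F), e)] : TermList F) :=
    hmons.map (hone.comp PolyFn.snd)
  have hpoly : ∀ (n : ℕ) (e : List ℕ),
      toPoly n [((1 : F), e)] = monomial (toExp n e) (1 : F) := fun n e => by simp
  obtain ⟨m, σ, ws, hσ, hws, hspec⟩ := exists_linearization hX hY hred hGB
    (fun i : Coded (CodesInst νX) X => (⟨i.obj.csp, ((monomials i.obj.csp.numVars d).map
      fun e => ([((1 : F), e)] : TermList F)).map (toPoly _)⟩ : Inst D))
    (fun i => hclosed _ i.mem _ fun g hg => by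
      obtain ⟨p, hp, rfl⟩ := List.mem_map.1 hg
      obtain ⟨e, he, rfl⟩ := List.mem_map.1 hp
      rw [hpoly]
      exact (totalDegree_monomial_le _ _).trans (degree_le_of_mem_monomials he))
    hM (fun i p hp => by
      obtain ⟨e, he, rfl⟩ := List.mem_map.1 hp
      simpa [HasArity] using length_of_mem_monomials he)
    (fun i => rfl) hc fun i => (h i).2.2
  have hσ' : PolyFn F fun q : Coded (CodesInst νX) X × List ℕ => (q.2, σ q.1 [((1 : F), q.2)]) :=
    PolyFn.snd.pair (hσ.comp (PolyFn.fst.pair (hone.comp PolyFn.snd)))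
  have hps : PolyFn F fun i : Coded (CodesInst νX) X =>
      (monomials i.obj.csp.numVars d).map fun e => (e, σ i [((1 : F), e)]) := hmons.map hσ'
  refine PolyFn.exists_polyTimeOn (PolyFn.flatMap (g := fun i e => withLeading
    ((monomials i.obj.csp.numVars d).map fun e => (e, σ i [((1 : F), e)])) (ws i)
    (e, σ i [((1 : F), e)])) hmons (PolyFn.withLeading
    (hps.comp PolyFn.fst) (hws.comp PolyFn.fst) hσ')) fun i => ?_
  obtain ⟨h1, h2, h3⟩ := hspec i
  obtain ⟨h4, h5⟩ := isTruncGroebner_withLeading (d := d) (J := i.obj.csp.ideal) (m := m i)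
    (σ := fun e => σ i [((1 : F), e)]) (fun e he => h2 _ (List.mem_map_of_mem he)) h1
    (fun es hes a => by
      have h6 := h3 (es.map fun e => [((1 : F), e)]) (List.map_subset _ hes) a
      simp only [List.map_map, Function.comp_def, hpoly] at h6
      rw [List.map_map]
      exact h6) rfl
  exact ⟨_, codesList_codesPoly_iff.2 ⟨_, h4, rfl, rfl⟩, h5⟩

end Reduction

end ChiIMP

theorem mainTheorem9 {F : Type*} [Field F] {D E : Finset F}
    (νX : ChiIMP.RelNotation D) (νY : ChiIMP.RelNotation E)
    (d r : ℕ) (hr : 1 ≤ r)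
    (X : Set (ChiIMP.Inst D)) (Y : Set (ChiIMP.Inst E))
    (hX : X ⊆ ChiIMP.chiIMP D d) (hY : Y ⊆ ChiIMP.chiIMP E (r * d))
    (S : ChiIMP.SubstCollection D E) (hS : ∀ i, S.arity i ≤ r)
    (hred : ChiIMP.SubstReducible νX νY X Y S)
    (hGB : ∃ B : ChiIMP.Prog F, ChiIMP.PolyTimeOn B (ChiIMP.CodesInst νY) Y fun I y =>
      ChiIMP.ListsGroebner I y ∨ ChiIMP.ListsTruncGroebner (r * d) I y) :
    (∃ p : ChiIMP.Prog F,
      ChiIMP.PolyTimeOn p (ChiIMP.CodesInst νX) X ChiIMP.Answers) ∧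
    ((∀ I ∈ X, ∀ M : List (MvPolynomial (Fin I.csp.numVars) F),
        (∀ g ∈ M, g.totalDegree ≤ d) → (⟨I.csp, M⟩ : ChiIMP.Inst D) ∈ X) →
      ∃ p : ChiIMP.Prog F,
        ChiIMP.PolyTimeOn p (ChiIMP.CodesInst νX) X (ChiIMP.ListsTruncGroebner d)) := by
  exact ⟨ChiIMP.exists_solver hX hY hred hGB,
    ChiIMP.exists_truncGroebner_program hX hY hred hGB⟩
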